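/- Let $\mathbb{R}^{4,2}$ be $\mathbb{R}^6$ with an inner product $(\cdot,\cdot)$ of signature $(-++++-)$. Let $\mathfrak p\in\mathbb{R}^{4,2}$ with $(\mathfrak p,\mathfrak p)=-1$ and $\mathfrak q\in\mathbb{R}^{4,2}\setminus\{0\}$ with $(\mathfrak q,\mathfrak p)=0$. The space form of curvature $-(\mathfrak q,\mathfrak q)$ is modelled by $Q=\{x : (x,x)=0,\ (x,\mathfrak p)=0,\ (x,\mathfrak q)=-1\}$, and its oriented planes by $T=\{x : (x,x)=0,\ (x,\mathfrak p)=-1,\ (x,\mathfrak q)=0\}$. Let $\Sigma$ be a smooth $2$-manifold, and let $\mathfrak f:\Sigma\to Q$ be a smooth surface, possibly with singularities, with smooth tangent plane congruence $\mathfrak t:\Sigma\to T$. That is, $(\mathfrak f,\mathfrak t)=(d\mathfrak f,\mathfrak t)=0$, and the Legendre lift $\Lambda=\langle \mathfrak f,\mathfrak t\rangle$ is a Legendre immersion: if $d\mathfrak f(X)$ and $d\mathfrak t(X)$ both lie in $\Lambda(x)$ for some $X\in T_x\Sigma$, then $X=0$. A sphere $\langle s\rangle\subset\Lambda(x)$ is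 a curvature sphere in a direction $X\neq 0$ if $d\mathfrak s(X)\in\Lambda(x)$ for the sections $\mathfrak s$ of $\Lambda$ with $\mathfrak s(x)=s$. Local coordinates $(u,v)$ are curvature line parameters if $\Lambda$ is spanned by a curvature sphere in the $u$-direction and one in the $v$-direction. Assume: 1. (umbilic-free) no sphere of $\Lambda(x)$ is a curvature sphere in all directions, for any $x\in\Sigma$; 2. (non-tubular linear Weingarten) there are constants $a,b,c\in\mathbb{R}$ with $ac-b^2\neq0$ such that, at every point, the two curvature spheres $s_1,s_2$ satisfy $$a\,(s_1,\mathfrak q)(s_2,\mathfrak q)+b\,\bigl((s_1,\mathfrak q)(s_2,\mathfrak p)+(s_1,\mathfrak p)(s_2,\mathfrak q)\bigr)+c\,(s_1,\mathfrak p)(s_2,\mathfrak p)=0 .$$ Where the principal curvatures $k_i=(s_i,\mathfrak q)/(s_i,\mathfrak p)$ are finite this means $aK+2bH+c=0$ with $K=k_1k_2$ and $H=\tfrac12(k_1+k_2)$; 3. (channel) locally, $\Lambda$ envelops a $1$-parameter family of spheres: near each point there are a smooth real function $\tau$ and a smooth curve $\gamma$ in $\mathbb{R}^{4,2}$ with $0\neq\gamma(\tau(y))\in\Lambda(y)$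 for all $y$ near that point. Then $\mathfrak f$ and its tangent plane congruence $\mathfrak t$ are isothermic in the following sense. (i) Around every point at which $\mathfrak f$ is an immersion there are curvature line parameters $(u,v)$ that are conformal for $\mathfrak f$, i.e. $(\mathfrak f_u,\mathfrak f_v)=0$ and $(\mathfrak f_u,\mathfrak f_u)=(\mathfrak f_v,\mathfrak f_v)>0$. Around every point at which $\mathfrak t$ is an immersion there are curvature line parameters that are conformal for $\mathfrak t$ in the same sense. (ii) Let $x\in\Sigma$, and let $\gamma,\tau$ describe, as in 3, a $1$-parameter family enveloped near $x$. If $(\gamma(\tau(x)),\mathfrak p)\neq0$ (the enveloped sphere at $x$ is not a point), then around $x$ there are curvature line parameters $(u,v)$ and a Moutard lift of $\mathfrak f$, i.e. $\mathfrak m=\mu\,\mathfrak f$ with $\mu$ smooth and nowhere zero and $\mathfrak m_{uv}\parallel\mathfrak m$. If $(\gamma(\tau(x)),\mathfrak q)\neq0$ (the enveloped sphere at $x$ is not a plane), the same holds for $\mathfrak t$. -/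

import Mathlib

open scoped Manifold ContDiff Topology

noncomputable section

namespace LieSphere

/-- The vector space underlying `ℝ^{4,2}`. -/
abbrev R42 : Type := Fin 6 → ℝ

/-- The plane `ℝ²` in which charts of a surface take values. -/
abbrev Plane : Type := EuclideanSpace ℝ (Fin 2)

/-- The inner product of `ℝ^{4,2}`, of signature `(- + + + + -)`. -/
def ip (x y : R42) : ℝ :=
  -(x 0 * y 0) + x 1 * y 1 + x 2 * y 2 + x 3 * y 3 + x 4 * y 4 - x 5 * y 5

/-- `p` is a point sphere complex and `q` a space form vector. The space form determined by
`(p, q)` has constant curvature `-(q, q)`. -/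
structure IsSpaceForm (p q : R42) : Prop where
  point_complex : ip p p = -1
  ne_zero : q ≠ 0
  orthogonal : ip p q = 0

/-- The points of the space form: null vectors `x` with `(x, p) = 0` and `(x, q) = -1`. -/
def spaceForm (p q : R42) : Set R42 :=
  {x | ip x x = 0 ∧ ip x p = 0 ∧ ip x q = -1}

/-- The oriented planes of the space form: null vectors `x` with `(x, p) = -1`, `(x, q) = 0`. -/
def planes (p q : R42) : Set R42 :=
  {x | ip x x = 0 ∧ ip x p = -1 ∧ ip x q = 0}

/-- The null plane (contact element) spanned by `x` and `y`. -/
def contact (x y : R42) : Submodule ℝ R42 := Submodule.span ℝ {x, y}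

/-- Let `F`, `T` be the values at a point of `f`, `t`, and `FX`, `TX` the derivatives of `f`, `t`
in a direction `X`. The vector `s` represents a sphere of the contact element `⟨F, T⟩` that is a
curvature sphere in the direction `X`: sections of `⟨f, t⟩` through `s` have `X`-derivative in
`⟨F, T⟩`. For a section `α f + β t` this derivative is `α FX + β TX` modulo `⟨F, T⟩`. -/
def IsCurvatureSphereIn (F T FX TX s : R42) : Prop :=
  s ≠ 0 ∧ ∃ α β : ℝ, s = α • F + β • T ∧ α • FX + β • TX ∈ contact F T

/-- The principal curvature `(s, q) / (s, p)` belonging to a curvature sphere `s`. -/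
def principalCurvature (p q s : R42) : ℝ := ip s q / ip s p

/-- The linear Weingarten condition for the curvature spheres `s₁`, `s₂`, in the form that is
independent of the choice of representatives and also makes sense where one of the principal
curvatures is infinite; see `lwRelation_iff`. -/
def LWRelation (p q : R42) (a b c : ℝ) (s₁ s₂ : R42) : Prop :=
  a * (ip s₁ q * ip s₂ q) + b * (ip s₁ q * ip s₂ p + ip s₁ p * ip s₂ q)
    + c * (ip s₁ p * ip s₂ p) = 0

/-- Where both principal curvatures are finite the condition reads `a K + 2 b H + c = 0`
with `K = k₁ k₂` and `H = (k₁ + k₂) / 2`. -/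
theorem lwRelation_iff (p q : R42) (a b c : ℝ) (s₁ s₂ : R42)
    (h₁ : ip s₁ p ≠ 0) (h₂ : ip s₂ p ≠ 0) :
    LWRelation p q a b c s₁ s₂ ↔
      a * (principalCurvature p q s₁ * principalCurvature p q s₂)
        + 2 * b * ((principalCurvature p q s₁ + principalCurvature p q s₂) / 2) + c = 0 := by
  have key : a * (principalCurvature p q s₁ * principalCurvature p q s₂)
        + 2 * b * ((principalCurvature p q s₁ + principalCurvature p q s₂) / 2) + c
      = (a * (ip s₁ q * ip s₂ q) + b * (ip s₁ q * ip s₂ p + ip s₁ p * ip s₂ q)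
          + c * (ip s₁ p * ip s₂ p)) / (ip s₁ p * ip s₂ p) := by
    unfold principalCurvature
    field_simp
  rw [key, div_eq_zero_iff]
  simp [LWRelation, h₁, h₂]

variable {M : Type*} [TopologicalSpace M] [ChartedSpace Plane M]

/-- The differential at `x` of an `ℝ^{4,2}`-valued map on a surface. -/
def diff (g : M → R42) (x : M) (X : TangentSpace (𝓡 2) x) : R42 :=
  mfderiv (𝓡 2) 𝓘(ℝ, R42) g x X

/-- `f` is a smooth map into the space form with smooth tangent plane congruence `t`, such that
the Legendre lift `⟨f, t⟩` is a Legendre immersion. The map `f` itself may have singularities; if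
`f` is an immersion, then `t = p + n` with `n` a unit normal field of `f`. -/
structure IsSurface (p q : R42) (f t : M → R42) : Prop where
  smooth_f : ContMDiff (𝓡 2) 𝓘(ℝ, R42) ∞ f
  smooth_t : ContMDiff (𝓡 2) 𝓘(ℝ, R42) ∞ t
  mem_f : ∀ x, f x ∈ spaceForm p q
  mem_t : ∀ x, t x ∈ planes p q
  incident : ∀ x, ip (f x) (t x) = 0
  tangent : ∀ x X, ip (diff f x X) (t x) = 0
  immersed : ∀ x X, diff f x X ∈ contact (f x) (t x) → diff t x X ∈ contact (f x) (t x) → X = 0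

/-- No sphere of a contact element is a curvature sphere in all directions. -/
def IsUmbilicFree (f t : M → R42) : Prop :=
  ∀ x, ¬ ∃ s, ∀ X, IsCurvatureSphereIn (f x) (t x) (diff f x X) (diff t x X) s

/-- The surface satisfies `a K + 2 b H + c = 0`. -/
def IsLinearWeingarten (p q : R42) (a b c : ℝ) (f t : M → R42) : Prop :=
  ∀ (x : M) (X₁ X₂ : TangentSpace (𝓡 2) x) (s₁ s₂ : R42),
    LinearIndependent ℝ ![X₁, X₂] →
    IsCurvatureSphereIn (f x) (t x) (diff f x X₁) (diff t x X₁) s₁ →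
    IsCurvatureSphereIn (f x) (t x) (diff f x X₂) (diff t x X₂) s₂ →
    LWRelation p q a b c s₁ s₂

/-- There is a non-trivial triple `(a, b, c)` with `a K + 2 b H + c = 0` and `a c - b² ≠ 0`. -/
def IsNonTubularLinearWeingarten (p q : R42) (f t : M → R42) : Prop :=
  ∃ a b c : ℝ, a * c - b ^ 2 ≠ 0 ∧ IsLinearWeingarten p q a b c f t

/-- Near `x` the Legendre lift `⟨f, t⟩` envelops the 1-parameter family of spheres `γ`, the sphere
touching the surface at `y` being the one with parameter `τ y`. -/
def EnvelopsNear (f t : M → R42) (x : M) (γ : ℝ → R42) (τ : M → ℝ) : Prop :=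
  ContDiff ℝ ∞ γ ∧ ∃ U : Set M, IsOpen U ∧ x ∈ U ∧ ContMDiffOn (𝓡 2) 𝓘(ℝ, ℝ) ∞ τ U ∧
    ∀ y ∈ U, γ (τ y) ≠ 0 ∧ γ (τ y) ∈ contact (f y) (t y)

/-- The Legendre lift envelops (locally) a 1-parameter family of spheres. -/
def IsChannel (f t : M → R42) : Prop :=
  ∀ x, ∃ γ τ, EnvelopsNear f t x γ τ

/-- The partial derivative `∂ᵢ h` of a function on `ℝ²`. -/
def pd (i : Fin 2) (h : Plane → R42) (y : Plane) : R42 :=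
  fderiv ℝ h y (EuclideanSpace.single i 1)

/-- The derivative of `g` in the direction of the `i`-th coordinate `(u, v)` of the chart `φ`. -/
def coordDeriv (φ : OpenPartialHomeomorph M Plane) (i : Fin 2) (g : M → R42) (z : M) : R42 :=
  pd i (g ∘ φ.symm) (φ z)

/-- The mixed derivative `g_{uv}` in the coordinates `(u, v)` of the chart `φ`. -/
def coordMixed (φ : OpenPartialHomeomorph M Plane) (g : M → R42) (z : M) : R42 :=
  pd 0 (pd 1 (g ∘ φ.symm)) (φ z)

/-- The coordinates `(u, v)` of `φ` are curvature line coordinates: the contact elements are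
spanned by curvature spheres `s₁`, `s₂` in the `u`- and the `v`-direction. -/
def IsCurvatureLineChart (f t : M → R42) (φ : OpenPartialHomeomorph M Plane) : Prop :=
  ∀ z ∈ φ.source, ∃ s₁ s₂, LinearIndependent ℝ ![s₁, s₂] ∧
    IsCurvatureSphereIn (f z) (t z) (coordDeriv φ 0 f z) (coordDeriv φ 0 t z) s₁ ∧
    IsCurvatureSphereIn (f z) (t z) (coordDeriv φ 1 f z) (coordDeriv φ 1 t z) s₂

/-- The coordinates `(u, v)` of `φ` are conformal for `g`. -/
def IsConformalChart (g : M → R42) (φ : OpenPartialHomeomorph M Plane) : Prop :=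
  ∀ z ∈ φ.source, ip (coordDeriv φ 0 g z) (coordDeriv φ 1 g z) = 0 ∧
    ip (coordDeriv φ 0 g z) (coordDeriv φ 0 g z) = ip (coordDeriv φ 1 g z) (coordDeriv φ 1 g z) ∧
    0 < ip (coordDeriv φ 0 g z) (coordDeriv φ 0 g z)

/-- In the coordinates `(u, v)` of `φ` the sphere congruence spanned by `g` has a Moutard lift
`m = μ g`, that is, `m_{uv} ∥ m`. -/
def HasMoutardLift (g : M → R42) (φ : OpenPartialHomeomorph M Plane) : Prop :=
  ∃ μ : M → ℝ, ContMDiffOn (𝓡 2) 𝓘(ℝ, ℝ) ∞ μ φ.source ∧ (∀ z ∈ φ.source, μ z ≠ 0) ∧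
    ∀ z ∈ φ.source, ∃ ρ : ℝ, coordMixed φ (fun w => μ w • g w) z = ρ • (μ z • g z)

/-- Around `x` there are conformal curvature line parameters for the enveloped congruence `g`. -/
def HasConformalCurvatureLineChartAt (f t g : M → R42) (x : M) : Prop :=
  ∃ φ ∈ IsManifold.maximalAtlas (𝓡 2) ∞ M, x ∈ φ.source ∧
    IsCurvatureLineChart f t φ ∧ IsConformalChart g φ

/-- Around `x` the enveloped sphere congruence `g` is isothermic: it has a Moutard lift with
respect to curvature line parameters. -/
def IsIsothermicAt (f t g : M → R42) (x : M) : Prop :=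
  ∃ φ ∈ IsManifold.maximalAtlas (𝓡 2) ∞ M, x ∈ φ.source ∧
    IsCurvatureLineChart f t φ ∧ HasMoutardLift g φ

end LieSphere

end

noncomputable section

namespace LieSphere

/-! ### The inner product -/

/-! Write the enveloped spheres as γ(τ) = A f + B t. Pairing with q and p gives A = -(γ, q) and B =
-(γ, p), so A and B are functions of τ alone. Differentiating along ker dτ yields A df + B dt = 0,
hence γ is a curvature sphere in that direction. In the coefficients with respect to f and t the
Weingarten relation is a symmetric bilinear form, nondegenerate because ac - b² ≠ 0. So the other
curvature sphere is s₂ = A₂ f + B₂ t with (A₂, B₂) = (-(bA + cB), aA + bB), again functions of τ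
alone. The absence of umbilics gives D = A B₂ - B A₂ ≠ 0 (`exists_second_curvature_direction`).

Expand (A₂, B₂)' = l (A, B) + m (A₂, B₂). Then ds₂ = (l γ + m s₂) dτ + A₂ df + B₂ dt. Choosing η' =
-m η and Γ' = l η γ, the section C = η s₂ - Γ(τ) has dC = η (A₂ df + B₂ dt), which vanishes in the
second curvature direction. Take v = τ and u a component of C: locally C is a function of u alone.
Solving γ and s₂ for f and t gives f = P(v) C(u) + E(v), and a formula of the same shape, with the
same C, for t (`exists_split_chart`).

Both kinds of isothermicity follow from this splitting. The lift f/P = C(u) + (E/P)(v) has vanishing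
mixed derivative. Since f is null, its metric is P² times that of f/P, that is P² (|C'(u)|² du² +
|(E/P)'(v)|² dv²), which becomes conformal after reparametrizing u and v separately. The factor P
vanishes exactly where (γ, p) does, and its analogue for t where (γ, q) does. At immersed points
this cannot happen, because P = 0 would kill the u-derivative. -/

lemma ip_comm (x y : R42) : ip x y = ip y x := by simp only [ip]; ring

@[simp] lemma ip_add_left (x y z : R42) : ip (x + y) z = ip x z + ip y z := by
  simp only [ip, Pi.add_apply]; ring

@[simp] lemma ip_sub_left (x y z : R42) : ip (x - y) z = ip x z - ip y z := by
  simp only [ip, Pi.sub_apply]; ring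

@[simp] lemma ip_smul_left (r : ℝ) (x z : R42) : ip (r • x) z = r * ip x z := by
  simp only [ip, Pi.smul_apply, smul_eq_mul]; ring

@[simp] lemma ip_neg_left (x z : R42) : ip (-x) z = -ip x z := by
  simp only [ip, Pi.neg_apply]; ring

@[simp] lemma ip_zero_left (z : R42) : ip 0 z = 0 := by simp [ip]

@[simp] lemma ip_add_right (x y z : R42) : ip z (x + y) = ip z x + ip z y := by
  simp only [ip, Pi.add_apply]; ring

@[simp] lemma ip_sub_right (x y z : R42) : ip z (x - y) = ip z x - ip z y := by
  simp only [ip, Pi.sub_apply]; ring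

@[simp] lemma ip_smul_right (r : ℝ) (x z : R42) : ip z (r • x) = r * ip z x := by
  simp only [ip, Pi.smul_apply, smul_eq_mul]; ring

@[simp] lemma ip_zero_right (z : R42) : ip z 0 = 0 := by simp [ip]

/-- The inner product as a continuous bilinear map. -/
def ipCLM : R42 →L[ℝ] R42 →L[ℝ] ℝ :=
  (LinearMap.mk₂ ℝ ip ip_add_left ip_smul_left (fun x y z => ip_add_right y z x)
    (fun c x y => ip_smul_right c y x)).toContinuousBilinearMap

@[simp] lemma ipCLM_apply (x y : R42) : ipCLM x y = ip x y := rfl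

lemma eq_zero_of_ip_self {x : R42} (h0 : x 0 = 0) (h5 : x 5 = 0) (hx : ip x x = 0) : x = 0 := by
  simp only [ip, h0, h5] at hx
  have h1 : x 1 = 0 := by nlinarith [sq_nonneg (x 1), sq_nonneg (x 2), sq_nonneg (x 3), sq_nonneg (x 4)]
  have h2 : x 2 = 0 := by nlinarith [sq_nonneg (x 1), sq_nonneg (x 2), sq_nonneg (x 3), sq_nonneg (x 4)]
  have h3 : x 3 = 0 := by nlinarith [sq_nonneg (x 1), sq_nonneg (x 2), sq_nonneg (x 3), sq_nonneg (x 4)]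
  have h4 : x 4 = 0 := by nlinarith [sq_nonneg (x 1), sq_nonneg (x 2), sq_nonneg (x 3), sq_nonneg (x 4)]
  funext i
  fin_cases i <;> assumption

lemma ip_self_nonneg {x : R42} (h0 : x 0 = 0) (h5 : x 5 = 0) : 0 ≤ ip x x := by
  simp only [ip, h0, h5]
  nlinarith [sq_nonneg (x 1), sq_nonneg (x 2), sq_nonneg (x 3), sq_nonneg (x 4)]

/-! ### Null planes -/

/-- The vectors `F`, `T` form a basis of a null plane. -/
structure IsNullPair (F T : R42) : Prop where
  null_left : ip F F = 0
  null_right : ip T T = 0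
  orthogonal : ip F T = 0
  indep : ∀ α β : ℝ, α • F + β • T = 0 → α = 0 ∧ β = 0

namespace IsNullPair

variable {F T : R42} (h : IsNullPair F T)
include h

/-- The combination is a null vector without time-like coordinates, so it lies where the form is
positive definite and must vanish. -/
lemma indep_neg {α β : ℝ} (h0 : α * F 0 + β * T 0 = 0) (h5 : α * F 5 + β * T 5 = 0) :
    α = 0 ∧ β = 0 := by
  apply h.indep
  apply eq_zero_of_ip_self
  · simpa using h0
  · simpa using h5
  · simp [h.null_left, h.null_right, h.orthogonal, ip_comm T F]

lemma det_ne_zero : F 0 * T 5 - F 5 * T 0 ≠ 0 := by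
  intro hd
  obtain ⟨hT0, hF0⟩ := h.indep_neg (α := T 0) (β := -F 0) (by ring) (by linarith)
  obtain ⟨hT5, hF5⟩ := h.indep_neg (α := T 5) (β := -F 5) (by linarith) (by ring)
  have := h.indep_neg (α := 1) (β := 0) (by linarith) (by linarith)
  exact one_ne_zero this.1

/-- Modulo a null plane every vector has vanishing time-like coordinates. -/
lemma exists_reduction (x : R42) :
    ∃ α β : ℝ, (x - (α • F + β • T)) 0 = 0 ∧ (x - (α • F + β • T)) 5 = 0 := by
  have hd := h.det_ne_zero
  obtain ⟨r, hr⟩ : ∃ r, (F 0 * T 5 - F 5 * T 0) * r = 1 := ⟨_, mul_inv_cancel₀ hd⟩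
  refine ⟨(x 0 * T 5 - x 5 * T 0) * r, (F 0 * x 5 - F 5 * x 0) * r, ?_, ?_⟩
  all_goals simp only [Pi.sub_apply, Pi.add_apply, Pi.smul_apply, smul_eq_mul]
  · linear_combination (-x 0) * hr
  · linear_combination (-x 5) * hr

lemma ip_sub_self {x y : R42} (hF : ip x F = 0) (hT : ip x T = 0) (hF' : ip y F = 0)
    (hT' : ip y T = 0) (α β α' β' : ℝ) :
    ip (x - (α • F + β • T)) (y - (α' • F + β' • T)) = ip x y := by
  simp [h.null_left, h.null_right, h.orthogonal, ip_comm T F, hF, hT, ip_comm F y, ip_comm T y,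
    hF', hT']

lemma ip_self_nonneg {x : R42} (hF : ip x F = 0) (hT : ip x T = 0) : 0 ≤ ip x x := by
  obtain ⟨α, β, h0, h5⟩ := h.exists_reduction x
  rw [← h.ip_sub_self hF hT hF hT α β α β]
  exact LieSphere.ip_self_nonneg h0 h5

/-- On the orthogonal complement of a null plane only the plane itself is null. -/
lemma exists_eq_of_ip_self {x : R42} (hF : ip x F = 0) (hT : ip x T = 0) (hx : ip x x = 0) :
    ∃ α β : ℝ, x = α • F + β • T := by
  obtain ⟨α, β, h0, h5⟩ := h.exists_reduction x
  rw [← h.ip_sub_self hF hT hF hT α β α β] at hx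
  exact ⟨α, β, sub_eq_zero.1 (eq_zero_of_ip_self h0 h5 hx)⟩

/-- The quotient of the orthogonal complement of a null plane by the plane has dimension two. -/
lemma ip_self_eq_zero_of_orthogonal {x y z : R42} (hxF : ip x F = 0) (hxT : ip x T = 0)
    (hyF : ip y F = 0) (hyT : ip y T = 0) (hzF : ip z F = 0) (hzT : ip z T = 0)
    (hxy : ip x y = 0) (hxz : ip x z = 0) (hyz : ip y z = 0) (hx : ip x x ≠ 0) (hy : ip y y ≠ 0) :
    ip z z = 0 := by
  by_contra hz
  obtain ⟨α, β, hx0, hx5⟩ := h.exists_reduction x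
  obtain ⟨α', β', hy0, hy5⟩ := h.exists_reduction y
  obtain ⟨α'', β'', hz0, hz5⟩ := h.exists_reduction z
  rw [← h.ip_sub_self hxF hxT hyF hyT α β α' β'] at hxy
  rw [← h.ip_sub_self hxF hxT hzF hzT α β α'' β''] at hxz
  rw [← h.ip_sub_self hyF hyT hzF hzT α' β' α'' β''] at hyz
  rw [← h.ip_sub_self hxF hxT hxF hxT α β α β] at hx
  rw [← h.ip_sub_self hyF hyT hyF hyT α' β' α' β'] at hy
  rw [← h.ip_sub_self hzF hzT hzF hzT α'' β'' α'' β''] at hz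
  have hF : ∀ (w : R42) (a b : ℝ), ip w F = 0 → ip w T = 0 → ip (w - (a • F + b • T)) F = 0 ∧
      ip (w - (a • F + b • T)) T = 0 := by
    intro w a b h1 h2
    simp [h1, h2, h.null_left, h.null_right, h.orthogonal, ip_comm T F]
  obtain ⟨hxF', hxT'⟩ := hF x α β hxF hxT
  obtain ⟨hyF', hyT'⟩ := hF y α' β' hyF hyT
  obtain ⟨hzF', hzT'⟩ := hF z α'' β'' hzF hzT
  generalize x - (α • F + β • T) = x' at *
  generalize y - (α' • F + β' • T) = y' at *
  generalize z - (α'' • F + β'' • T) = z' at *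
  -- If z were non-null as well, these would be seven independent vectors in a six-dimensional
  -- space.
  have hli : LinearIndependent ℝ
      ![x', y', z', F, T, (Pi.single 0 1 : R42), (Pi.single 5 1 : R42)] := by
    rw [Fintype.linearIndependent_iff]
    intro g hg
    simp only [Fin.sum_univ_succ, Fin.sum_univ_zero, Matrix.cons_val_zero, Matrix.cons_val_succ,
      add_zero] at hg
    have e0 : ∀ w : R42, w 0 = 0 → ip w (Pi.single 0 1) = 0 := by
      intro w hw; simp [ip, hw]
    have e5 : ∀ w : R42, w 5 = 0 → ip w (Pi.single 5 1) = 0 := by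
      intro w hw; simp [ip, hw]
    have gx := congrArg (ip x') hg
    have gy := congrArg (ip y') hg
    have gz := congrArg (ip z') hg
    simp only [ip_add_right, ip_smul_right, ip_zero_right, hxy, hxz, hxF', hxT', e0 _ hx0,
      e5 _ hx5, mul_zero, add_zero, mul_eq_zero, hx, or_false] at gx
    simp only [ip_add_right, ip_smul_right, ip_zero_right, ip_comm y' x', hxy, hyz, hyF', hyT',
      e0 _ hy0, e5 _ hy5, mul_zero, add_zero, zero_add, mul_eq_zero, hy, or_false] at gy
    simp only [ip_add_right, ip_smul_right, ip_zero_right, ip_comm z' x', ip_comm z' y', hxz, hyz,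
      hzF', hzT', e0 _ hz0, e5 _ hz5, mul_zero, add_zero, zero_add, mul_eq_zero, hz,
      or_false] at gz
    simp only [gx, gy, gz, zero_smul, zero_add] at hg
    obtain ⟨v, hv⟩ : ∃ v, v = g (Fin.succ (Fin.succ (Fin.succ 0))) • F +
      g (Fin.succ (Fin.succ (Fin.succ (Fin.succ 0)))) • T := ⟨_, rfl⟩
    have hvv : ip v v = 0 := by
      simp [hv, h.null_left, h.null_right, h.orthogonal, ip_comm T F]
    rw [← add_assoc, ← hv] at hg
    have c := fun i => congrFun hg i
    have c0 := c 0
    have c1 := c 1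
    have c2 := c 2
    have c3 := c 3
    have c4 := c 4
    have c5 := c 5
    simp at c0 c1 c2 c3 c4 c5
    -- By `hg`, v is a combination of the two time-like basis vectors, where the form is negative
    -- definite; but v is null.
    have hv0 : v 0 ^ 2 + v 5 ^ 2 = 0 := by
      simp only [ip, c1, c2, c3, c4] at hvv
      linarith
    have hv0' : v 0 = 0 := by nlinarith [sq_nonneg (v 0), sq_nonneg (v 5)]
    have hv5' : v 5 = 0 := by nlinarith [sq_nonneg (v 0), sq_nonneg (v 5)]
    obtain ⟨k3, k4⟩ := h.indep _ _ (hv.symm.trans (eq_zero_of_ip_self hv0' hv5' hvv))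
    intro i
    fin_cases i
    · exact gx
    · exact gy
    · exact gz
    · exact k3
    · exact k4
    · simpa [hv0'] using c0
    · simpa [hv5'] using c5
  have := hli.fintype_card_le_finrank
  simp at this

end IsNullPair

/-! ### Curvature spheres of an infinitesimal Legendre immersion -/

lemma mem_contact {F T x : R42} : x ∈ contact F T ↔ ∃ α β : ℝ, α • F + β • T = x :=
  Submodule.mem_span_pair

/-- The values `F`, `T` and differentials `dF`, `dT` at a point of a surface and its tangent plane
congruence, for a linear Weingarten surface without umbilics. -/
structure IsLegendreJet (p q : R42) (a b c : ℝ) (F T : R42) (dF dT : Plane →L[ℝ] R42) : Prop where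
  pair : IsNullPair F T
  ip_F_p : ip F p = 0
  ip_F_q : ip F q = -1
  ip_T_p : ip T p = -1
  ip_T_q : ip T q = 0
  ip_dF_p : ∀ X, ip (dF X) p = 0
  ip_dF_q : ∀ X, ip (dF X) q = 0
  ip_dT_p : ∀ X, ip (dT X) p = 0
  ip_dT_q : ∀ X, ip (dT X) q = 0
  ip_dF_F : ∀ X, ip (dF X) F = 0
  ip_dF_T : ∀ X, ip (dF X) T = 0
  ip_dT_F : ∀ X, ip (dT X) F = 0
  ip_dT_T : ∀ X, ip (dT X) T = 0
  symm : ∀ X Y, ip (dF X) (dT Y) = ip (dF Y) (dT X)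
  immersed : ∀ X, dF X = 0 → dT X = 0 → X = 0
  umbilic_free : ∀ A B : ℝ, (∀ X, A • dF X + B • dT X = 0) → A = 0 ∧ B = 0
  weingarten : ∀ X Y, LinearIndependent ℝ ![X, Y] → ∀ A B A' B' : ℝ,
    A • dF X + B • dT X = 0 → A' • dF Y + B' • dT Y = 0 →
    a * (A * A') + b * (A * B' + B * A') + c * (B * B') = 0

namespace IsLegendreJet

variable {p q F T : R42} {a b c : ℝ} {dF dT : Plane →L[ℝ] R42}
  (h : IsLegendreJet p q a b c F T dF dT)
include h

lemma ip_self_nonneg (A B : ℝ) (X : Plane) :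
    0 ≤ ip (A • dF X + B • dT X) (A • dF X + B • dT X) :=
  h.pair.ip_self_nonneg (by simp [h.ip_dF_F, h.ip_dT_F]) (by simp [h.ip_dF_T, h.ip_dT_T])

/-- A null vector orthogonal to the contact element lies in it. Derivatives are orthogonal to p and
q, whereas α F + β T pairs with them to -β and -α. Hence lying in the contact element already means
vanishing, and curvature sphere conditions become exact equations. -/
lemma eq_zero_of_ip_self {A B : ℝ} {X : Plane}
    (hX : ip (A • dF X + B • dT X) (A • dF X + B • dT X) = 0) : A • dF X + B • dT X = 0 := by
  obtain ⟨α, β, hαβ⟩ := h.pair.exists_eq_of_ip_self (by simp [h.ip_dF_F, h.ip_dT_F])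
    (by simp [h.ip_dF_T, h.ip_dT_T]) hX
  have hp := congrArg (ip · p) hαβ
  have hq := congrArg (ip · q) hαβ
  simp [h.ip_dF_p, h.ip_dT_p, h.ip_F_p, h.ip_T_p] at hp
  simp [h.ip_dF_q, h.ip_dT_q, h.ip_F_q, h.ip_T_q] at hq
  rw [hαβ, hp, hq, zero_smul, zero_smul, add_zero]

/-- Two distinct spheres of a contact element cannot be curvature spheres in the same direction of a
Legendre immersion. -/
lemma eq_zero_of_det_ne_zero {A B A' B' : ℝ} (hd : A * B' - B * A' ≠ 0) {X : Plane}
    (hX : A • dF X + B • dT X = 0) (hX' : A' • dF X + B' • dT X = 0) : X = 0 := by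
  apply h.immersed
  · have : (A * B' - B * A') • dF X =
        B' • (A • dF X + B • dT X) - B • (A' • dF X + B' • dT X) := by module
    rw [hX, hX', smul_zero, smul_zero, sub_zero] at this
    exact (smul_eq_zero.1 this).resolve_left hd
  · have : (A * B' - B * A') • dT X =
        A • (A' • dF X + B' • dT X) - A' • (A • dF X + B • dT X) := by module
    rw [hX, hX', smul_zero, smul_zero, sub_zero] at this
    exact (smul_eq_zero.1 this).resolve_left hd

/-- One curvature sphere determines the other one by the linear Weingarten condition. -/
lemma exists_second_curvature_direction (habc : a * c - b ^ 2 ≠ 0) {A B : ℝ}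
    (hAB : A ≠ 0 ∨ B ≠ 0) {X : Plane} (hX : X ≠ 0) (hAX : A • dF X + B • dT X = 0) :
    A * (a * A + b * B) - B * (-(b * A + c * B)) ≠ 0 ∧ ∃ Y, LinearIndependent ℝ ![X, Y] ∧
      (-(b * A + c * B)) • dF Y + (a * A + b * B) • dT Y = 0 := by
  have hn : A ^ 2 + B ^ 2 ≠ 0 := by
    rcases hAB with h | h <;> positivity
  -- Put S = A dF + B dT and N = -B dF + A dT. Since S X = 0, the immersion condition forces N X ≠
  -- 0.
  have hNX : ip ((-B) • dF X + A • dT X) ((-B) • dF X + A • dT X) ≠ 0 := by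
    intro h0
    refine hX (h.eq_zero_of_det_ne_zero (by convert hn using 1; ring) hAX
      (h.eq_zero_of_ip_self h0))
  obtain ⟨Y₀, hY₀⟩ : ∃ Y, A • dF Y + B • dT Y ≠ 0 := by
    by_contra! hcon
    have := h.umbilic_free A B hcon
    tauto
  obtain ⟨k, hk⟩ : ∃ k, ip ((-B) • dF Y₀ + A • dT Y₀) ((-B) • dF X + A • dT X) =
      k * ip ((-B) • dF X + A • dT X) ((-B) • dF X + A • dT X) :=
    ⟨_, (div_mul_cancel₀ _ hNX).symm⟩
  -- Gram–Schmidt: this makes N Y orthogonal to N X, and S Y = S Y₀ because S X = 0.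
  obtain ⟨Y, hY⟩ : ∃ Y, Y = Y₀ - k • X := ⟨_, rfl⟩
  have hSY' : A • dF Y + B • dT Y = A • dF Y₀ + B • dT Y₀ := by
    have : A • dF Y + B • dT Y = (A • dF Y₀ + B • dT Y₀) - k • (A • dF X + B • dT X) := by
      rw [hY, map_sub, map_sub, map_smul, map_smul]; module
    rw [this, hAX, smul_zero, sub_zero]
  have hSY : A • dF Y + B • dT Y ≠ 0 := by rwa [hSY']
  have hNN : ip ((-B) • dF X + A • dT X) ((-B) • dF Y + A • dT Y) = 0 := by
    have : (-B) • dF Y + A • dT Y =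
        ((-B) • dF Y₀ + A • dT Y₀) - k • ((-B) • dF X + A • dT X) := by
      rw [hY, map_sub, map_sub, map_smul, map_smul]; module
    rw [this, ip_sub_right, ip_smul_right, ip_comm _ ((-B) • dF Y₀ + A • dT Y₀), hk, sub_self]
  have hNS : ip ((-B) • dF X + A • dT X) (A • dF Y + B • dT Y) = 0 := by
    have h1 : ip (A • dF X + B • dT X) ((-B) • dF Y + A • dT Y) = 0 := by
      rw [hAX, ip_zero_left]
    have h2 : ip ((-B) • dF X + A • dT X) (A • dF Y + B • dT Y) =
        ip (A • dF X + B • dT X) ((-B) • dF Y + A • dT Y) := by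
      simp only [ip_add_left, ip_add_right, ip_smul_left, ip_smul_right]
      rw [ip_comm (dT X) (dF Y), h.symm Y X]
      ring
    rw [h2, h1]
  have hSS : ip (A • dF Y + B • dT Y) (A • dF Y + B • dT Y) ≠ 0 :=
    fun h0 => hSY (h.eq_zero_of_ip_self h0)
  obtain ⟨r, hr⟩ : ∃ r, ip (A • dF Y + B • dT Y) ((-B) • dF Y + A • dT Y) =
      r * ip (A • dF Y + B • dT Y) (A • dF Y + B • dT Y) :=
    ⟨_, (div_mul_cancel₀ _ hSS).symm⟩
  have hZ : (-B - r * A) • dF Y + (A - r * B) • dT Y =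
      ((-B) • dF Y + A • dT Y) - r • (A • dF Y + B • dT Y) := by module
  -- N X and S Y are orthogonal and non-null, so they span the two-dimensional definite quotient of
  -- the orthogonal complement by the contact element. N Y - r S Y is orthogonal to both.
  have hZ0 : (-B - r * A) • dF Y + (A - r * B) • dT Y = 0 := by
    apply h.eq_zero_of_ip_self
    refine h.pair.ip_self_eq_zero_of_orthogonal (x := (-B) • dF X + A • dT X)
      (y := A • dF Y + B • dT Y) ?_ ?_ ?_ ?_ ?_ ?_ hNS ?_ ?_ hNX hSS
    any_goals simp [h.ip_dF_F, h.ip_dT_F, h.ip_dF_T, h.ip_dT_T]; done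
    · rw [hZ, ip_sub_right, ip_smul_right, hNN, hNS]; ring
    · rw [hZ, ip_sub_right, ip_smul_right, hr]; ring
  have hli : LinearIndependent ℝ ![X, Y] := by
    rw [LinearIndependent.pair_iff]
    intro s t hst
    have h1 : t • (A • dF Y + B • dT Y) = 0 := by
      have h2 : A • dF (s • X + t • Y) + B • dT (s • X + t • Y) =
          s • (A • dF X + B • dT X) + t • (A • dF Y + B • dT Y) := by
        simp only [map_add, map_smul]; module
      rwa [hst, hAX, map_zero, map_zero, smul_zero, smul_zero, smul_zero, add_zero, zero_add,
        eq_comm] at h2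
    have ht : t = 0 := (smul_eq_zero.1 h1).resolve_right hSY
    subst ht
    rw [zero_smul, add_zero] at hst
    exact ⟨(smul_eq_zero.1 hst).resolve_right hX, rfl⟩
  have hw := h.weingarten X Y hli A B _ _ hAX hZ0
  have hn' : (-(b * A + c * B)) ^ 2 + (a * A + b * B) ^ 2 ≠ 0 := by
    intro h0
    have h1 : b * A + c * B = 0 := by nlinarith [sq_nonneg (b * A + c * B), sq_nonneg (a * A + b * B)]
    have h2 : a * A + b * B = 0 := by nlinarith [sq_nonneg (b * A + c * B), sq_nonneg (a * A + b * B)]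
    have hA : A = 0 := by
      have : (a * c - b ^ 2) * A = 0 := by linear_combination c * h2 - b * h1
      exact (mul_eq_zero.1 this).resolve_left habc
    have hB : B = 0 := by
      have : (a * c - b ^ 2) * B = 0 := by linear_combination a * h1 - b * h2
      exact (mul_eq_zero.1 this).resolve_left habc
    tauto
  obtain ⟨A₂, hA₂⟩ : ∃ A₂, A₂ = -(b * A + c * B) := ⟨_, rfl⟩
  obtain ⟨B₂, hB₂⟩ : ∃ B₂, B₂ = a * A + b * B := ⟨_, rfl⟩
  rw [← hA₂, ← hB₂] at hn' ⊢
  -- The Weingarten relation is linear in the second pair of coefficients, so it makes that pair a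
  -- multiple l of (A₂, B₂).
  have hprop : B₂ * (-B - r * A) = A₂ * (A - r * B) := by
    rw [hA₂, hB₂]; linear_combination hw
  obtain ⟨l, hl⟩ : ∃ l, A₂ * (-B - r * A) + B₂ * (A - r * B) = l * (A₂ ^ 2 + B₂ ^ 2) :=
    ⟨_, (div_mul_cancel₀ _ hn').symm⟩
  have hlA : -B - r * A = l * A₂ := by
    refine mul_left_cancel₀ hn' ?_
    linear_combination A₂ * hl + B₂ * hprop
  have hlB : A - r * B = l * B₂ := by
    refine mul_left_cancel₀ hn' ?_
    linear_combination B₂ * hl - A₂ * hprop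
  -- One identity shows both that the two spheres are distinct and that l can be cancelled.
  have hD : l * (A * B₂ - B * A₂) = A ^ 2 + B ^ 2 := by
    linear_combination B * hlA - A * hlB
  refine ⟨fun h0 => hn (by rw [← hD, h0, mul_zero]), Y, hli, ?_⟩
  have hl0 : l ≠ 0 := fun h0 => hn (by rw [← hD, h0, zero_mul])
  rw [hlA, hlB, mul_smul, mul_smul, ← smul_add] at hZ0
  exact (smul_eq_zero.1 hZ0).resolve_left hl0

/-- The two curvature directions are orthogonal for `F` and for `T`. -/
lemma ip_eq_zero_of_curvature_directions {A B A' B' : ℝ} (hd : A * B' - B * A' ≠ 0) {X Y : Plane}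
    (hX : A • dF X + B • dT X = 0) (hY : A' • dF Y + B' • dT Y = 0) :
    ip (dF X) (dF Y) = 0 ∧ ip (dT X) (dT Y) = 0 := by
  have h1 := congrArg (ip · (dF Y)) hX
  have h2 := congrArg (ip · (dT Y)) hX
  have h3 := congrArg (ip (dF X)) hY
  have h4 := congrArg (ip (dT X)) hY
  simp only [ip_add_left, ip_add_right, ip_smul_left, ip_smul_right, ip_zero_left,
    ip_zero_right] at h1 h2 h3 h4
  rw [ip_comm (dT X) (dF Y), h.symm Y X] at h1 h4
  constructor
  · refine (mul_eq_zero.1 (?_ : (A * B' - B * A') * _ = 0)).resolve_left hd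
    linear_combination B' * h1 - B * h3
  · refine (mul_eq_zero.1 (?_ : (A * B' - B * A') * _ = 0)).resolve_left hd
    linear_combination A * h4 - A' * h2

end IsLegendreJet

/-! ### Charts -/

lemma plane_eq (X : Plane) :
    X = X 0 • EuclideanSpace.single 0 1 + X 1 • EuclideanSpace.single 1 1 := by
  ext i
  fin_cases i <;> simp

lemma exists_eq_of_linearIndependent {X Y : Plane} (hXY : LinearIndependent ℝ ![X, Y]) (Z : Plane) :
    ∃ r s : ℝ, Z = r • X + s • Y := by
  have hspan := hXY.span_eq_top_of_card_eq_finrank (by simp)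
  have hZ : Z ∈ Submodule.span ℝ (Set.range ![X, Y]) := by rw [hspan]; trivial
  rw [Matrix.range_cons_cons_empty, Submodule.mem_span_pair] at hZ
  obtain ⟨r, s, rfl⟩ := hZ
  exact ⟨r, s, rfl⟩

/-- The map of the plane with the given coordinate functions. -/
def planeMap (U V : Plane → ℝ) (w : Plane) : Plane := WithLp.toLp 2 ![U w, V w]

@[simp] lemma planeMap_zero (U V : Plane → ℝ) (w : Plane) : planeMap U V w 0 = U w := rfl
@[simp] lemma planeMap_one (U V : Plane → ℝ) (w : Plane) : planeMap U V w 1 = V w := rfl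

lemma contDiffOn_planeMap {U V : Plane → ℝ} {W : Set Plane} (hU : ContDiffOn ℝ ∞ U W)
    (hV : ContDiffOn ℝ ∞ V W) : ContDiffOn ℝ ∞ (planeMap U V) W := by
  rw [contDiffOn_euclidean]
  intro i
  fin_cases i
  · exact hU
  · exact hV

lemma fderiv_coord {Φ : Plane → Plane} {w : Plane} (hΦ : DifferentiableAt ℝ Φ w) (X : Plane)
    (i : Fin 2) : fderiv ℝ Φ w X i = fderiv ℝ (fun v => Φ v i) w X := by
  have h := (EuclideanSpace.proj i : Plane →L[ℝ] ℝ).hasFDerivAt (x := Φ w).comp w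
    hΦ.hasFDerivAt
  have h' : HasFDerivAt (fun v => Φ v i) _ w := h
  rw [h'.fderiv]
  rfl

variable {M : Type*} [TopologicalSpace M] [ChartedSpace Plane M]

/-- The inverse function theorem, with U and V as new coordinates. The source is cut down to where
the differential stays invertible, so that the inverse is smooth on the whole target. -/
lemma exists_chart [IsManifold (𝓡 2) ∞ M] {φ : OpenPartialHomeomorph M Plane}
    (hφ : φ ∈ IsManifold.maximalAtlas (𝓡 2) ∞ M) {x : M} (hx : x ∈ φ.source) {U V : Plane → ℝ}
    {W : Set Plane} (hW : IsOpen W) (hxW : φ x ∈ W) (hU : ContDiffOn ℝ ∞ U W)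
    (hV : ContDiffOn ℝ ∞ V W)
    (hinj : ∀ X, fderiv ℝ U (φ x) X = 0 → fderiv ℝ V (φ x) X = 0 → X = 0) :
    ∃ φ' ∈ IsManifold.maximalAtlas (𝓡 2) ∞ M, x ∈ φ'.source ∧ φ'.source ⊆ φ.source ∧
      (∀ z ∈ φ'.source, φ z ∈ W) ∧ ∀ z ∈ φ'.source, φ' z = planeMap U V (φ z) := by
  have hΦ := contDiffOn_planeMap hU hV
  have hΦx : ContDiffAt ℝ ∞ (planeMap U V) (φ x) := hΦ.contDiffAt (hW.mem_nhds hxW)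
  have hdiff : ∀ w ∈ W, DifferentiableAt ℝ (planeMap U V) w := fun w hw =>
    (hΦ.contDiffAt (hW.mem_nhds hw)).differentiableAt (by simp)
  have hker : LinearMap.ker (fderiv ℝ (planeMap U V) (φ x) : Plane →ₗ[ℝ] Plane) = ⊥ := by
    rw [LinearMap.ker_eq_bot']
    intro X hX
    apply hinj
    · have := fderiv_coord (hdiff _ hxW) X 0
      simp only [planeMap_zero] at this
      rw [← this]
      exact congrArg (fun Z : Plane => Z 0) hX
    · have := fderiv_coord (hdiff _ hxW) X 1
      simp only [planeMap_one] at this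
      rw [← this]
      exact congrArg (fun Z : Plane => Z 1) hX
  obtain ⟨e, he⟩ : ∃ e : Plane ≃L[ℝ] Plane, (e : Plane →L[ℝ] Plane) =
      fderiv ℝ (planeMap U V) (φ x) := by
    refine ⟨(LinearEquiv.ofInjectiveEndo (fderiv ℝ (planeMap U V) (φ x) : Plane →ₗ[ℝ] Plane)
      (LinearMap.ker_eq_bot.1 hker)).toContinuousLinearEquiv, ?_⟩
    ext1 X
    rfl
  have hd : HasFDerivAt (planeMap U V) (e : Plane →L[ℝ] Plane) (φ x) := by
    rw [he]; exact (hdiff _ hxW).hasFDerivAt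
  let Ψ₀ := hΦx.toOpenPartialHomeomorph (planeMap U V) hd (by simp)
  -- the derivative stays invertible on a smaller open set
  have hcont : ContinuousOn (fderiv ℝ (planeMap U V)) W :=
    hΦ.continuousOn_fderiv_of_isOpen hW (by simp)
  let R : Set Plane := W ∩ fderiv ℝ (planeMap U V) ⁻¹'
    (Set.range ((↑) : (Plane ≃L[ℝ] Plane) → Plane →L[ℝ] Plane))
  have hR : IsOpen R := hcont.isOpen_inter_preimage hW ContinuousLinearEquiv.isOpen
  let Ψ := Ψ₀.restrOpen R hR
  have hΨx : φ x ∈ Ψ.source :=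
    ⟨hΦx.mem_toOpenPartialHomeomorph_source hd (by simp), hxW, e, he⟩
  have hΨcoe : ∀ w, Ψ w = planeMap U V w := fun w => rfl
  have hΨR : ∀ w ∈ Ψ.source, w ∈ R := fun w hw => hw.2
  have hsymm : ContDiffOn ℝ ∞ Ψ.symm Ψ.target := by
    intro v hv
    have hw := Ψ.map_target hv
    obtain ⟨hwW, e', he'⟩ := hΨR _ hw
    refine (Ψ.contDiffAt_symm (f₀' := e') hv ?_ ?_).contDiffWithinAt
    · rw [he']; exact (hdiff _ hwW).hasFDerivAt
    · exact hΦ.contDiffAt (hW.mem_nhds hwW)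
  refine ⟨φ.trans Ψ, ?_, ?_, ?_, ?_, ?_⟩
  · apply OpenPartialHomeomorph.mem_maximalAtlas_of_contMDiffOn
    · have h1 : ContMDiffOn (𝓡 2) (𝓡 2) ∞ φ φ.source := contMDiffOn_of_mem_maximalAtlas hφ
      have h2 : ContMDiffOn (𝓡 2) (𝓡 2) ∞ Ψ Ψ.source :=
        (hΦ.mono fun w hw => (hΨR w hw).1).contMDiffOn
      exact h2.comp (h1.mono (by simp)) (fun z hz => hz.2)
    · have h1 : ContMDiffOn (𝓡 2) (𝓡 2) ∞ φ.symm φ.target :=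
        contMDiffOn_symm_of_mem_maximalAtlas hφ
      have h2 : ContMDiffOn (𝓡 2) (𝓡 2) ∞ Ψ.symm Ψ.target := hsymm.contMDiffOn
      exact h1.comp (h2.mono fun v hv => hv.1) (fun v hv => hv.2)
  · exact ⟨hx, hΨx⟩
  · exact fun z hz => hz.1
  · exact fun z hz => (hΨR _ hz.2).1
  · exact fun z hz => rfl

/-! ### Smoothness and differentials read in a chart. -/

section Transfer

variable {E : Type*} [NormedAddCommGroup E] [NormedSpace ℝ E]

lemma contDiffOn_comp_symm [IsManifold (𝓡 2) ∞ M] {φ : OpenPartialHomeomorph M Plane}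
    (hφ : φ ∈ IsManifold.maximalAtlas (𝓡 2) ∞ M) {g : M → E} {s : Set M}
    (hg : ContMDiffOn (𝓡 2) 𝓘(ℝ, E) ∞ g s) :
    ContDiffOn ℝ ∞ (g ∘ φ.symm) (φ.target ∩ φ.symm ⁻¹' s) := by
  have h1 : ContMDiffOn (𝓡 2) (𝓡 2) ∞ φ.symm φ.target := contMDiffOn_symm_of_mem_maximalAtlas hφ
  exact (hg.comp (h1.mono Set.inter_subset_left) (fun v hv => hv.2)).contDiffOn

/-- One bijection L, the differential of `φ.symm`, serves all maps g at once; conditions linking df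
and dt can thus be carried between the surface and the plane. -/
lemma exists_tangentMap [IsManifold (𝓡 2) ∞ M] {φ : OpenPartialHomeomorph M Plane}
    (hφ : φ ∈ IsManifold.maximalAtlas (𝓡 2) ∞ M) {w : Plane} (hw : w ∈ φ.target) :
    ∃ L : Plane →ₗ[ℝ] TangentSpace (𝓡 2) (φ.symm w), Function.Bijective L ∧
      ∀ g : M → R42, ContMDiff (𝓡 2) 𝓘(ℝ, R42) ∞ g → ∀ X,
        fderiv ℝ (g ∘ φ.symm) w X = diff g (φ.symm w) (L X) := by
  have hmd : φ.MDifferentiable (𝓡 2) (𝓡 2) :=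
    ⟨(contMDiffOn_of_mem_maximalAtlas hφ).mdifferentiableOn (by simp),
      (contMDiffOn_symm_of_mem_maximalAtlas hφ).mdifferentiableOn (by simp)⟩
  refine ⟨(mfderiv (𝓡 2) (𝓡 2) φ.symm w).toLinearMap, hmd.symm.mfderiv_bijective hw, ?_⟩
  intro g hg X
  have h := mfderiv_comp w ((hg (φ.symm w)).mdifferentiableAt (by simp)) (hmd.mdifferentiableAt_symm hw)
  rw [← mfderiv_eq_fderiv]
  exact congrArg (fun l => l X) h

end Transfer

/-! ### Functions of one variable -/

lemma exists_antiderivative {E : Type*} [NormedAddCommGroup E] [NormedSpace ℝ E] [CompleteSpace E]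
    {g : ℝ → E} {r₁ r₂ : ℝ} (hg : ContDiffOn ℝ ∞ g (Set.Ioo r₁ r₂)) :
    ∃ G : ℝ → E, ContDiffOn ℝ ∞ G (Set.Ioo r₁ r₂) ∧
      ∀ s ∈ Set.Ioo r₁ r₂, HasDerivAt G (g s) s := by
  rcases (Set.Ioo r₁ r₂).eq_empty_or_nonempty with he | ⟨s₀, hs₀⟩
  · exact ⟨0, by simp [he], by simp [he]⟩
  have hd : ∀ s ∈ Set.Ioo r₁ r₂, HasDerivAt (fun s => ∫ r in s₀..s, g r) (g s) s := by
    intro s hs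
    have hsub : Set.uIcc s₀ s ⊆ Set.Ioo r₁ r₂ := Set.ordConnected_Ioo.uIcc_subset hs₀ hs
    refine intervalIntegral.integral_hasDerivAt_right
      (hg.continuousOn.mono hsub).intervalIntegrable ?_ ?_
    · exact hg.continuousOn.stronglyMeasurableAtFilter isOpen_Ioo s hs
    · exact hg.continuousOn.continuousAt (isOpen_Ioo.mem_nhds hs)
  refine ⟨fun s => ∫ r in s₀..s, g r, ?_, hd⟩
  rw [contDiffOn_infty_iff_deriv_of_isOpen isOpen_Ioo]
  exact ⟨fun s hs => (hd s hs).differentiableAt.differentiableWithinAt,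
    hg.congr fun s hs => (hd s hs).deriv⟩

lemma exists_Ioo_subset {O : Set ℝ} (hO : IsOpen O) {s : ℝ} (hs : s ∈ O) :
    ∃ ε > 0, Set.Ioo (s - ε) (s + ε) ⊆ O := by
  obtain ⟨ε, hε, hsub⟩ := Metric.isOpen_iff.1 hO s hs
  exact ⟨ε, hε, by rwa [← Real.ball_eq_Ioo]⟩

/-- Data along a curve of spheres `γ` that integrate the second family of curvature spheres of a
linear Weingarten surface that envelops it. -/
structure IsIntegratingPair (A B A₂ B₂ : ℝ → ℝ) (γ : ℝ → R42) (J : Set ℝ) (η : ℝ → ℝ)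
    (Γ : ℝ → R42) : Prop where
  isOpen : IsOpen J
  det_ne_zero : ∀ s ∈ J, A s * B₂ s - B s * A₂ s ≠ 0
  smooth_η : ContDiffOn ℝ ∞ η J
  smooth_Γ : ContDiffOn ℝ ∞ Γ J
  η_ne_zero : ∀ s, η s ≠ 0
  deriv_eq : ∀ s ∈ J, ∃ l m, deriv A₂ s = l * A s + m * A₂ s ∧ deriv B₂ s = l * B s + m * B₂ s ∧
    HasDerivAt η (-m * η s) s ∧ HasDerivAt Γ ((l * η s) • γ s) s

/-- Cramer's rule gives l and m, with D in the denominator; then η = exp(-∫ m) and Γ = ∫ l η γ on an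
interval where D ≠ 0. -/
lemma exists_isIntegratingPair {A B A₂ B₂ : ℝ → ℝ} {γ : ℝ → R42} (hA : ContDiff ℝ ∞ A)
    (hB : ContDiff ℝ ∞ B) (hA₂ : ContDiff ℝ ∞ A₂) (hB₂ : ContDiff ℝ ∞ B₂) (hγ : ContDiff ℝ ∞ γ)
    {s₀ : ℝ} (hs₀ : A s₀ * B₂ s₀ - B s₀ * A₂ s₀ ≠ 0) :
    ∃ J η Γ, s₀ ∈ J ∧ IsIntegratingPair A B A₂ B₂ γ J η Γ := by
  have hD : ContDiff ℝ ∞ fun s => A s * B₂ s - B s * A₂ s := (hA.mul hB₂).sub (hB.mul hA₂)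
  obtain ⟨ε, hε, hJ⟩ := exists_Ioo_subset (isOpen_ne.preimage hD.continuous) hs₀
  have hdA : ContDiff ℝ ∞ (deriv A₂) := (contDiff_infty_iff_deriv.1 hA₂).2
  have hdB : ContDiff ℝ ∞ (deriv B₂) := (contDiff_infty_iff_deriv.1 hB₂).2
  have hm : ContDiffOn ℝ ∞ (fun s => (A s * deriv B₂ s - B s * deriv A₂ s) /
      (A s * B₂ s - B s * A₂ s)) (Set.Ioo (s₀ - ε) (s₀ + ε)) :=
    ((hA.mul hdB).sub (hB.mul hdA)).contDiffOn.div hD.contDiffOn fun s hs => hJ hs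
  have hl : ContDiffOn ℝ ∞ (fun s => (deriv A₂ s * B₂ s - deriv B₂ s * A₂ s) /
      (A s * B₂ s - B s * A₂ s)) (Set.Ioo (s₀ - ε) (s₀ + ε)) :=
    ((hdA.mul hB₂).sub (hdB.mul hA₂)).contDiffOn.div hD.contDiffOn fun s hs => hJ hs
  obtain ⟨N, hN, hN'⟩ := exists_antiderivative hm
  have hη : ContDiffOn ℝ ∞ (fun s => Real.exp (-N s)) (Set.Ioo (s₀ - ε) (s₀ + ε)) := hN.neg.exp
  obtain ⟨Γ, hΓ, hΓ'⟩ := exists_antiderivative ((hl.mul hη).smul hγ.contDiffOn)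
  refine ⟨Set.Ioo (s₀ - ε) (s₀ + ε), fun s => Real.exp (-N s), Γ, ⟨by linarith, by linarith⟩,
    isOpen_Ioo, fun s hs => hJ hs, hη, hΓ, fun s => (Real.exp_pos _).ne', ?_⟩
  intro s hs
  have hDs : A s * B₂ s - B s * A₂ s ≠ 0 := hJ hs
  refine ⟨_, (A s * deriv B₂ s - B s * deriv A₂ s) / (A s * B₂ s - B s * A₂ s), ?_, ?_, ?_,
    hΓ' s hs⟩
  · rw [div_mul_eq_mul_div, div_mul_eq_mul_div, ← add_div, eq_div_iff hDs]
    ring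
  · rw [div_mul_eq_mul_div, div_mul_eq_mul_div, ← add_div, eq_div_iff hDs]
    ring
  · exact HasDerivAt.congr_deriv (hN' s hs).neg.exp (mul_comm _ _)

/-! ### The second family of curvature spheres -/

/-- The section `η (A₂ F + B₂ T) - Γ` that is constant along the second family of curvature
lines. -/
def secondFamily (A₂ B₂ η : ℝ → ℝ) (Γ : ℝ → R42) (F T : Plane → R42) (σ : Plane → ℝ) (w : Plane) :
    R42 :=
  η (σ w) • (A₂ (σ w) • F w + B₂ (σ w) • T w) - Γ (σ w)

/-- All terms containing dσ cancel: the choice of η removes the multiple of s₂ = A₂ F + B₂ T, and Γ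
removes the multiple of γ. -/
lemma hasFDerivAt_secondFamily {A B A₂ B₂ : ℝ → ℝ} {γ : ℝ → R42} {J : Set ℝ} {η : ℝ → ℝ}
    {Γ : ℝ → R42} (h : IsIntegratingPair A B A₂ B₂ γ J η Γ) (hA₂ : ContDiff ℝ ∞ A₂)
    (hB₂ : ContDiff ℝ ∞ B₂) {F T : Plane → R42} {σ : Plane → ℝ} {w : Plane}
    (hF : DifferentiableAt ℝ F w) (hT : DifferentiableAt ℝ T w) (hσ : DifferentiableAt ℝ σ w)
    (hw : σ w ∈ J) (hγ : γ (σ w) = A (σ w) • F w + B (σ w) • T w) :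
    HasFDerivAt (secondFamily A₂ B₂ η Γ F T σ)
      (η (σ w) • (A₂ (σ w) • fderiv ℝ F w + B₂ (σ w) • fderiv ℝ T w)) w := by
  obtain ⟨l, m, h1, h2, h3, h4⟩ := h.deriv_eq _ hw
  have dA := ((hA₂.differentiable (by simp)) (σ w)).hasDerivAt.comp_hasFDerivAt w hσ.hasFDerivAt
  have dB := ((hB₂.differentiable (by simp)) (σ w)).hasDerivAt.comp_hasFDerivAt w hσ.hasFDerivAt
  have dη := h3.comp_hasFDerivAt w hσ.hasFDerivAt
  have dΓ := h4.hasFDerivAt.comp w hσ.hasFDerivAt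
  have key := (dη.smul ((dA.smul hF.hasFDerivAt).add (dB.smul hT.hasFDerivAt))).sub dΓ
  refine HasFDerivAt.congr_fderiv key ?_
  ext1 X
  simp only [h1, h2, hγ, Function.comp_apply, add_apply,
    sub_apply, smul_apply,
    ContinuousLinearMap.smulRight_apply, ContinuousLinearMap.comp_apply,
    ContinuousLinearMap.toSpanSingleton_apply, smul_eq_mul, Pi.smul_apply', Pi.add_apply]
  module

/-! ### The jet of a surface in a chart -/

lemma fderiv_ip {G H : Plane → R42} {w : Plane} (hG : DifferentiableAt ℝ G w)
    (hH : DifferentiableAt ℝ H w) (X : Plane) :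
    fderiv ℝ (fun v => ip (G v) (H v)) w X =
      ip (fderiv ℝ G w X) (H w) + ip (G w) (fderiv ℝ H w X) := by
  have h := ipCLM.hasFDerivAt_of_bilinear hG.hasFDerivAt hH.hasFDerivAt
  have h' : HasFDerivAt (fun v => ip (G v) (H v)) _ w := h
  rw [h'.fderiv]
  simp [add_comm]

lemma ip_fderiv_eq_zero {G H : Plane → R42} {w : Plane} {W : Set Plane} (hW : IsOpen W)
    (hw : w ∈ W) (hG : DifferentiableAt ℝ G w) (hH : DifferentiableAt ℝ H w) {r : ℝ}
    (hr : ∀ v ∈ W, ip (G v) (H v) = r) (X : Plane) :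
    ip (fderiv ℝ G w X) (H w) + ip (G w) (fderiv ℝ H w X) = 0 := by
  rw [← fderiv_ip hG hH]
  have : (fun v => ip (G v) (H v)) =ᶠ[𝓝 w] fun _ => r := by
    filter_upwards [hW.mem_nhds hw] with v hv using hr v hv
  rw [this.fderiv_eq]
  simp

lemma IsSurface.isNullPair {p q : R42} {f t : M → R42} (h : IsSurface p q f t) (x : M) :
    IsNullPair (f x) (t x) := by
  obtain ⟨f1, f2, f3⟩ := h.mem_f x
  obtain ⟨t1, t2, t3⟩ := h.mem_t x
  refine ⟨f1, t1, h.incident x, fun α β hαβ => ?_⟩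
  have hp := congrArg (ip · p) hαβ
  have hq := congrArg (ip · q) hαβ
  simp [f2, f3, t2, t3] at hp hq
  exact ⟨hq, hp⟩

lemma contDiffAt_comp_symm [IsManifold (𝓡 2) ∞ M] {φ : OpenPartialHomeomorph M Plane}
    (hφ : φ ∈ IsManifold.maximalAtlas (𝓡 2) ∞ M) {g : M → R42}
    (hg : ContMDiff (𝓡 2) 𝓘(ℝ, R42) ∞ g) {w : Plane} (hw : w ∈ φ.target) :
    ContDiffAt ℝ ∞ (g ∘ φ.symm) w := by
  have := contDiffOn_comp_symm hφ hg.contMDiffOn (s := Set.univ)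
  rw [Set.preimage_univ, Set.inter_univ] at this
  exact this.contDiffAt (φ.open_target.mem_nhds hw)

theorem IsSurface.isLegendreJet [IsManifold (𝓡 2) ∞ M] {p q : R42} {f t : M → R42}
    (h : IsSurface p q f t) (humb : IsUmbilicFree f t) {a b c : ℝ}
    (hLW : IsLinearWeingarten p q a b c f t) {φ : OpenPartialHomeomorph M Plane}
    (hφ : φ ∈ IsManifold.maximalAtlas (𝓡 2) ∞ M) {w : Plane} (hw : w ∈ φ.target) :
    IsLegendreJet p q a b c ((f ∘ φ.symm) w) ((t ∘ φ.symm) w) (fderiv ℝ (f ∘ φ.symm) w)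
      (fderiv ℝ (t ∘ φ.symm) w) := by
  have hF : ∀ v ∈ φ.target, ContDiffAt ℝ ∞ (f ∘ φ.symm) v := fun v hv =>
    contDiffAt_comp_symm hφ h.smooth_f hv
  have hT : ∀ v ∈ φ.target, ContDiffAt ℝ ∞ (t ∘ φ.symm) v := fun v hv =>
    contDiffAt_comp_symm hφ h.smooth_t hv
  have dF := (hF w hw).differentiableAt (by simp)
  have dT := (hT w hw).differentiableAt (by simp)
  have tang : ∀ v ∈ φ.target, ∀ X, ip (fderiv ℝ (f ∘ φ.symm) v X) ((t ∘ φ.symm) v) = 0 := by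
    intro v hv X
    obtain ⟨L, -, hL⟩ := exists_tangentMap hφ hv
    rw [hL f h.smooth_f X]
    exact h.tangent _ _
  have dc : ∀ k : R42, DifferentiableAt ℝ (fun _ : Plane => k) w := fun k =>
    differentiableAt_const k
  have z1 : ∀ X, ip (fderiv ℝ (f ∘ φ.symm) w X) p = 0 := fun X => by
    simpa using ip_fderiv_eq_zero φ.open_target hw dF (dc p)
      (fun v hv => (h.mem_f (φ.symm v)).2.1) X
  have z2 : ∀ X, ip (fderiv ℝ (f ∘ φ.symm) w X) q = 0 := fun X => by
    simpa using ip_fderiv_eq_zero φ.open_target hw dF (dc q)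
      (fun v hv => (h.mem_f (φ.symm v)).2.2) X
  have z3 : ∀ X, ip (fderiv ℝ (t ∘ φ.symm) w X) p = 0 := fun X => by
    simpa using ip_fderiv_eq_zero φ.open_target hw dT (dc p)
      (fun v hv => (h.mem_t (φ.symm v)).2.1) X
  have z4 : ∀ X, ip (fderiv ℝ (t ∘ φ.symm) w X) q = 0 := fun X => by
    simpa using ip_fderiv_eq_zero φ.open_target hw dT (dc q)
      (fun v hv => (h.mem_t (φ.symm v)).2.2) X
  have z5 : ∀ X, ip (fderiv ℝ (f ∘ φ.symm) w X) ((f ∘ φ.symm) w) = 0 := fun X => by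
    have := ip_fderiv_eq_zero φ.open_target hw dF dF (fun v hv => (h.mem_f (φ.symm v)).1) X
    rw [ip_comm ((f ∘ φ.symm) w)] at this
    linarith
  have z6 : ∀ X, ip (fderiv ℝ (t ∘ φ.symm) w X) ((t ∘ φ.symm) w) = 0 := fun X => by
    have := ip_fderiv_eq_zero φ.open_target hw dT dT (fun v hv => (h.mem_t (φ.symm v)).1) X
    rw [ip_comm ((t ∘ φ.symm) w)] at this
    linarith
  have z7 : ∀ X, ip (fderiv ℝ (t ∘ φ.symm) w X) ((f ∘ φ.symm) w) = 0 := fun X => by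
    have := ip_fderiv_eq_zero φ.open_target hw dF dT (fun v hv => h.incident (φ.symm v)) X
    rw [tang w hw, ip_comm, zero_add] at this
    exact this
  -- Differentiating (df X, t) = 0 along Y gives (df X, dt Y) = -(d²f(Y, X), t), and second
  -- derivatives are symmetric.
  have hsymm : ∀ X Y, ip (fderiv ℝ (f ∘ φ.symm) w X) (fderiv ℝ (t ∘ φ.symm) w Y) =
      ip (fderiv ℝ (f ∘ φ.symm) w Y) (fderiv ℝ (t ∘ φ.symm) w X) := by
    have d2 : DifferentiableAt ℝ (fderiv ℝ (f ∘ φ.symm)) w :=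
      ((hF w hw).fderiv_right (m := 1) (by norm_cast)).differentiableAt (by simp)
    have key : ∀ X Y, ip (fderiv ℝ (fderiv ℝ (f ∘ φ.symm)) w Y X) ((t ∘ φ.symm) w) +
        ip (fderiv ℝ (f ∘ φ.symm) w X) (fderiv ℝ (t ∘ φ.symm) w Y) = 0 := by
      intro X Y
      have hd : HasFDerivAt (fun v => fderiv ℝ (f ∘ φ.symm) v X)
          ((fderiv ℝ (fderiv ℝ (f ∘ φ.symm)) w).flip X) w := by
        have := d2.hasFDerivAt.clm_apply (hasFDerivAt_const X w)
        refine this.congr_fderiv ?_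
        ext1 Z
        simp
      have := ip_fderiv_eq_zero φ.open_target hw hd.differentiableAt dT
        (fun v hv => tang v hv X) Y
      rwa [hd.fderiv] at this
    have hs : IsSymmSndFDerivAt ℝ (f ∘ φ.symm) w :=
      (hF w hw).isSymmSndFDerivAt (by rw [minSmoothness_of_isRCLikeNormedField]; norm_cast)
    intro X Y
    have k1 := key X Y
    have k2 := key Y X
    rw [hs.eq X Y] at k2
    linarith
  obtain ⟨L, hLbij, hL⟩ := exists_tangentMap hφ hw
  have hF' := hL f h.smooth_f
  have hT' := hL t h.smooth_t
  have hp := h.isNullPair (φ.symm w)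
  obtain ⟨-, f2, f3⟩ := h.mem_f (φ.symm w)
  obtain ⟨-, t2, t3⟩ := h.mem_t (φ.symm w)
  refine ⟨hp, f2, f3, t2, t3, z1, z2, z3, z4, z5, tang w hw, z7, z6, hsymm, ?_, ?_, ?_⟩
  · intro X hX hX'
    rw [hF'] at hX
    rw [hT'] at hX'
    have := h.immersed (φ.symm w) (L X) (by rw [hX]; exact zero_mem _)
      (by rw [hX']; exact zero_mem _)
    exact hLbij.1 (by rw [this, map_zero])
  · intro A B hAB
    by_contra hne
    refine humb (φ.symm w) ⟨A • f (φ.symm w) + B • t (φ.symm w), fun X => ?_⟩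
    obtain ⟨X, rfl⟩ := hLbij.2 X
    refine ⟨fun h0 => hne (hp.indep _ _ h0), A, B, rfl, ?_⟩
    have := hAB X
    rw [hF', hT'] at this
    rw [this]
    exact zero_mem _
  · intro X Y hXY A B A' B' h1 h2
    -- A zero pair of coefficients represents no sphere, but the relation is then trivial.
    by_cases hAB : A = 0 ∧ B = 0
    · rw [hAB.1, hAB.2]; ring
    by_cases hAB' : A' = 0 ∧ B' = 0
    · rw [hAB'.1, hAB'.2]; ring
    have hli : LinearIndependent ℝ ![L X, L Y] := by
      rw [LinearIndependent.pair_iff] at hXY ⊢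
      intro r s hrs
      exact hXY r s (hLbij.1 (by rw [map_add, map_smul, map_smul, hrs, map_zero]))
    rw [hF', hT'] at h1 h2
    have := hLW (φ.symm w) (L X) (L Y) (A • f (φ.symm w) + B • t (φ.symm w))
      (A' • f (φ.symm w) + B' • t (φ.symm w)) hli
      ⟨fun h0 => hAB (hp.indep _ _ h0), A, B, rfl, by rw [h1]; exact zero_mem _⟩
      ⟨fun h0 => hAB' (hp.indep _ _ h0), A', B', rfl, by rw [h2]; exact zero_mem _⟩
    simp only [LWRelation, ip_add_left, ip_smul_left, f2, f3, t2, t3] at this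
    linarith

/-- In the coordinates `(u, v)` of `φ`, which are orthogonal for `g`, the map `g` has the form
`P(v) C(u) + E(v)`. -/
structure IsSplitChart (g : M → R42) (J : Set ℝ) (P : ℝ → ℝ) (E : ℝ → R42) (C : Plane → R42)
    (φ : OpenPartialHomeomorph M Plane) : Prop where
  mem_J : ∀ w ∈ φ.target, w 1 ∈ J
  smooth_C : ContDiffOn ℝ ∞ C φ.target
  pd_C : ∀ w ∈ φ.target, pd 1 C w = 0
  eq_split : ∀ w ∈ φ.target, g (φ.symm w) = P (w 1) • C w + E (w 1)
  orthogonal : ∀ w ∈ φ.target, ip (pd 0 (g ∘ φ.symm) w) (pd 1 (g ∘ φ.symm) w) = 0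

/-! ### Construction of split charts from the enveloped spheres. -/

lemma curvature_sphere_of_enveloped {p q : R42} {F T : Plane → R42} {w : Plane}
    (hF : DifferentiableAt ℝ F w) (hT : DifferentiableAt ℝ T w) {γ : ℝ → R42}
    (hγ : ContDiff ℝ ∞ γ) {σ : Plane → ℝ} (hσ : DifferentiableAt ℝ σ w)
    (henv : ∀ᶠ v in 𝓝 w, γ (σ v) = (-ip (γ (σ v)) q) • F v + (-ip (γ (σ v)) p) • T v) {X : Plane}
    (hX : fderiv ℝ σ w X = 0) :
    (-ip (γ (σ w)) q) • fderiv ℝ F w X + (-ip (γ (σ w)) p) • fderiv ℝ T w X = 0 := by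
  have hγ' : HasFDerivAt (fun v => γ (σ v)) _ w :=
    ((hγ.differentiable (by simp)) (σ w)).hasFDerivAt.comp w hσ.hasFDerivAt
  have hk : ∀ k : R42, HasFDerivAt (fun v => -ip (γ (σ v)) k)
      (-((ipCLM.flip k).comp ((fderiv ℝ γ (σ w)).comp (fderiv ℝ σ w)))) w := fun k =>
    ((ipCLM.flip k).hasFDerivAt.comp w hγ').neg
  have h1 := ((hk q).smul hF.hasFDerivAt).add ((hk p).smul hT.hasFDerivAt)
  have h2 := (h1.congr_of_eventuallyEq henv).unique hγ'
  have h3 := congrArg (fun l => l X) h2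
  simpa [hX] using h3

/-- The primes on `P'` and `E'` mark the data belonging to t; they are not derivatives. All
one-variable data are fixed before O, so the chart can afterwards be confined to parameters where a
chosen factor is nonzero. -/
theorem exists_split_chart [IsManifold (𝓡 2) ∞ M] {p q : R42} {f t : M → R42}
    (h : IsSurface p q f t) (humb : IsUmbilicFree f t) {a b c : ℝ} (habc : a * c - b ^ 2 ≠ 0)
    (hLW : IsLinearWeingarten p q a b c f t) {x : M} {γ : ℝ → R42} {τ : M → ℝ}
    (henv : EnvelopsNear f t x γ τ) :
    ∃ (J : Set ℝ) (P P' : ℝ → ℝ) (E E' : ℝ → R42), IsOpen J ∧ τ x ∈ J ∧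
      ContDiffOn ℝ ∞ P J ∧ ContDiffOn ℝ ∞ E J ∧ ContDiffOn ℝ ∞ P' J ∧ ContDiffOn ℝ ∞ E' J ∧
      (∀ s ∈ J, P s = 0 ↔ ip (γ s) p = 0) ∧ (∀ s ∈ J, P' s = 0 ↔ ip (γ s) q = 0) ∧
      ∀ O : Set ℝ, IsOpen O → τ x ∈ O → ∃ φ ∈ IsManifold.maximalAtlas (𝓡 2) ∞ M,
        x ∈ φ.source ∧ φ x 1 = τ x ∧ IsCurvatureLineChart f t φ ∧
        ∃ C, IsSplitChart f (J ∩ O) P E C φ ∧ IsSplitChart t (J ∩ O) P' E' C φ := by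
  obtain ⟨hγ, U, hU, hxU, hτ, hmem⟩ := henv
  obtain ⟨A, hA⟩ : ∃ A : ℝ → ℝ, A = fun s => -ip (γ s) q := ⟨_, rfl⟩
  obtain ⟨B, hB⟩ : ∃ B : ℝ → ℝ, B = fun s => -ip (γ s) p := ⟨_, rfl⟩
  have sk : ∀ k : R42, ContDiff ℝ ∞ fun s => -ip (γ s) k := fun k =>
    ((ipCLM.flip k).contDiff.comp hγ).neg
  have sA : ContDiff ℝ ∞ A := hA ▸ sk q
  have sB : ContDiff ℝ ∞ B := hB ▸ sk p
  obtain ⟨A₂, hA₂⟩ : ∃ A₂ : ℝ → ℝ, A₂ = fun s => -(b * A s + c * B s) := ⟨_, rfl⟩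
  obtain ⟨B₂, hB₂⟩ : ∃ B₂ : ℝ → ℝ, B₂ = fun s => a * A s + b * B s := ⟨_, rfl⟩
  have sA₂ : ContDiff ℝ ∞ A₂ :=
    hA₂ ▸ ((contDiff_const.mul sA).add (contDiff_const.mul sB)).neg
  have sB₂ : ContDiff ℝ ∞ B₂ := hB₂ ▸ (contDiff_const.mul sA).add (contDiff_const.mul sB)
  -- the enveloped spheres as a section of the Legendre lift
  have hsec : ∀ y ∈ U, γ (τ y) = A (τ y) • f y + B (τ y) • t y := by
    intro y hy
    obtain ⟨α, β, hαβ⟩ := mem_contact.1 (hmem y hy).2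
    obtain ⟨-, f2, f3⟩ := h.mem_f y
    obtain ⟨-, t2, t3⟩ := h.mem_t y
    have e1 : A (τ y) = α := by rw [hA]; simp [← hαβ, f3, t3]
    have e2 : B (τ y) = β := by rw [hB]; simp [← hαβ, f2, t2]
    rw [e1, e2, hαβ]
  have hne : ∀ y ∈ U, A (τ y) ≠ 0 ∨ B (τ y) ≠ 0 := by
    intro y hy
    by_contra! hcon
    apply (hmem y hy).1
    rw [hsec y hy, hcon.1, hcon.2, zero_smul, zero_smul, add_zero]
  -- the chart-wise statements
  have hloc : ∀ φ ∈ IsManifold.maximalAtlas (𝓡 2) ∞ M, ∀ w ∈ φ.target, φ.symm w ∈ U →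
      DifferentiableAt ℝ (τ ∘ φ.symm) w ∧
      (∀ X, fderiv ℝ (τ ∘ φ.symm) w X = 0 → A (τ (φ.symm w)) • fderiv ℝ (f ∘ φ.symm) w X +
        B (τ (φ.symm w)) • fderiv ℝ (t ∘ φ.symm) w X = 0) := by
    intro φ hφ w hw hwU
    have hopen : IsOpen (φ.target ∩ φ.symm ⁻¹' U) := φ.isOpen_inter_preimage_symm hU
    have dτ : DifferentiableAt ℝ (τ ∘ φ.symm) w :=
      ((contDiffOn_comp_symm hφ hτ).contDiffAt (hopen.mem_nhds ⟨hw, hwU⟩)).differentiableAt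
        (by simp)
    refine ⟨dτ, fun X hX => ?_⟩
    have hev : ∀ᶠ v in 𝓝 w, γ ((τ ∘ φ.symm) v) = (-ip (γ ((τ ∘ φ.symm) v)) q) • (f ∘ φ.symm) v +
        (-ip (γ ((τ ∘ φ.symm) v)) p) • (t ∘ φ.symm) v := by
      filter_upwards [hopen.mem_nhds ⟨hw, hwU⟩] with v hv
      have := hsec _ hv.2
      rw [hA, hB] at this
      exact this
    have := curvature_sphere_of_enveloped
      ((contDiffAt_comp_symm hφ h.smooth_f hw).differentiableAt (by simp))
      ((contDiffAt_comp_symm hφ h.smooth_t hw).differentiableAt (by simp)) hγ dτ hev hX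
    rw [hA, hB]
    exact this
  obtain ⟨ψ, hψ⟩ : ∃ ψ : OpenPartialHomeomorph M Plane, ψ = chartAt Plane x := ⟨_, rfl⟩
  have hψa : ψ ∈ IsManifold.maximalAtlas (𝓡 2) ∞ M := by
    rw [hψ]; exact IsManifold.chart_mem_maximalAtlas x
  have hxψ : x ∈ ψ.source := by rw [hψ]; exact mem_chart_source _ x
  have hxt : ψ x ∈ ψ.target := ψ.map_source hxψ
  have hxx : ψ.symm (ψ x) = x := ψ.left_inv hxψ
  obtain ⟨dτx, hker⟩ := hloc ψ hψa (ψ x) hxt (by rwa [hxx])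
  have jx := h.isLegendreJet humb hLW hψa hxt
  rw [hxx] at hker
  -- A functional on a plane has a nontrivial kernel, so nothing need be known yet about dτ at x.
  obtain ⟨X, hX, hτX⟩ : ∃ X, X ≠ 0 ∧ fderiv ℝ (τ ∘ ψ.symm) (ψ x) X = 0 := by
    have hk : LinearMap.ker (fderiv ℝ (τ ∘ ψ.symm) (ψ x) : Plane →ₗ[ℝ] ℝ) ≠ ⊥ := by
      intro hbot
      have := LinearMap.finrank_le_finrank_of_injective (LinearMap.ker_eq_bot.1 hbot)
      simp at this
    obtain ⟨X, hX, hX0⟩ := Submodule.exists_mem_ne_zero_of_ne_bot hk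
    exact ⟨X, hX0, hX⟩
  obtain ⟨hD, Y, hXY, hY⟩ := jx.exists_second_curvature_direction habc (hne x hxU) hX (hker X hτX)
  have hA₂' : ∀ s, -(b * A s + c * B s) = A₂ s := fun s => by rw [hA₂]
  have hB₂' : ∀ s, a * A s + b * B s = B₂ s := fun s => by rw [hB₂]
  rw [hA₂', hB₂'] at hD hY
  obtain ⟨J, η, Γ, hxJ, hJ⟩ := exists_isIntegratingPair sA sB sA₂ sB₂ hγ hD
  have sD : ContDiffOn ℝ ∞ (fun s => A s * B₂ s - B s * A₂ s) J :=
    ((sA.mul sB₂).sub (sB.mul sA₂)).contDiffOn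
  have sηD : ContDiffOn ℝ ∞ (fun s => (η s * (A s * B₂ s - B s * A₂ s))⁻¹) J :=
    (hJ.smooth_η.mul sD).inv fun s hs => mul_ne_zero (hJ.η_ne_zero s) (hJ.det_ne_zero s hs)
  have sDi : ContDiffOn ℝ ∞ (fun s => (A s * B₂ s - B s * A₂ s)⁻¹) J :=
    sD.inv fun s hs => hJ.det_ne_zero s hs
  have sP : ContDiffOn ℝ ∞ (fun s => -B s * (η s * (A s * B₂ s - B s * A₂ s))⁻¹) J :=
    sB.neg.contDiffOn.mul sηD
  have sP' : ContDiffOn ℝ ∞ (fun s => A s * (η s * (A s * B₂ s - B s * A₂ s))⁻¹) J :=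
    sA.contDiffOn.mul sηD
  -- These coefficients come from f = (B₂ γ - B s₂)/D and t = (-A₂ γ + A s₂)/D after substituting s₂
  -- = (C + Γ)/η.
  refine ⟨J, fun s => -B s * (η s * (A s * B₂ s - B s * A₂ s))⁻¹,
    fun s => A s * (η s * (A s * B₂ s - B s * A₂ s))⁻¹,
    fun s => (B₂ s * (A s * B₂ s - B s * A₂ s)⁻¹) • γ s +
      (-B s * (η s * (A s * B₂ s - B s * A₂ s))⁻¹) • Γ s,
    fun s => (-A₂ s * (A s * B₂ s - B s * A₂ s)⁻¹) • γ s +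
      (A s * (η s * (A s * B₂ s - B s * A₂ s))⁻¹) • Γ s, hJ.isOpen, hxJ, sP,
    ((sB₂.contDiffOn.mul sDi).smul hγ.contDiffOn).add (sP.smul hJ.smooth_Γ), sP',
    ((sA₂.neg.contDiffOn.mul sDi).smul hγ.contDiffOn).add (sP'.smul hJ.smooth_Γ), ?_, ?_, ?_⟩
  · intro s hs
    have := mul_ne_zero (hJ.η_ne_zero s) (hJ.det_ne_zero s hs)
    rw [mul_eq_zero, or_iff_left (inv_ne_zero this)]
    simp [hB]
  · intro s hs
    have := mul_ne_zero (hJ.η_ne_zero s) (hJ.det_ne_zero s hs)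
    rw [mul_eq_zero, or_iff_left (inv_ne_zero this)]
    simp [hA]
  intro O hO hxO
  -- derivative of the second family
  have hsf : ∀ φ ∈ IsManifold.maximalAtlas (𝓡 2) ∞ M, ∀ w ∈ φ.target, φ.symm w ∈ U →
      τ (φ.symm w) ∈ J → HasFDerivAt
        (secondFamily A₂ B₂ η Γ (f ∘ φ.symm) (t ∘ φ.symm) (τ ∘ φ.symm))
        (η (τ (φ.symm w)) • (A₂ (τ (φ.symm w)) • fderiv ℝ (f ∘ φ.symm) w +
          B₂ (τ (φ.symm w)) • fderiv ℝ (t ∘ φ.symm) w)) w := by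
    intro φ hφ w hw hwU hwJ
    exact hasFDerivAt_secondFamily hJ sA₂ sB₂
      ((contDiffAt_comp_symm hφ h.smooth_f hw).differentiableAt (by simp))
      ((contDiffAt_comp_symm hφ h.smooth_t hw).differentiableAt (by simp))
      (hloc φ hφ w hw hwU).1 hwJ (hsec _ hwU)
  have hssf : ∀ φ ∈ IsManifold.maximalAtlas (𝓡 2) ∞ M, ∀ W ⊆ φ.target, (∀ w ∈ W, φ.symm w ∈ U) →
      (∀ w ∈ W, τ (φ.symm w) ∈ J) →
      ContDiffOn ℝ ∞ (secondFamily A₂ B₂ η Γ (f ∘ φ.symm) (t ∘ φ.symm) (τ ∘ φ.symm)) W := by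
    intro φ hφ W hW hWU hWJ
    have sτ : ContDiffOn ℝ ∞ (τ ∘ φ.symm) W :=
      (contDiffOn_comp_symm hφ hτ).mono fun w hw => ⟨hW hw, hWU w hw⟩
    have sF : ContDiffOn ℝ ∞ (f ∘ φ.symm) W := fun w hw =>
      (contDiffAt_comp_symm hφ h.smooth_f (hW hw)).contDiffWithinAt
    have sT : ContDiffOn ℝ ∞ (t ∘ φ.symm) W := fun w hw =>
      (contDiffAt_comp_symm hφ h.smooth_t (hW hw)).contDiffWithinAt
    exact ((hJ.smooth_η.comp sτ hWJ).smul (((sA₂.comp_contDiffOn sτ).smul sF).add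
      ((sB₂.comp_contDiffOn sτ).smul sT))).sub (hJ.smooth_Γ.comp sτ hWJ)
  obtain ⟨W, hWdef⟩ : ∃ W : Set Plane, W = (ψ.target ∩ ψ.symm ⁻¹' U) ∩
    (τ ∘ ψ.symm) ⁻¹' (J ∩ O) := ⟨_, rfl⟩
  have hW : IsOpen W := by
    rw [hWdef]
    exact (contDiffOn_comp_symm hψa hτ).continuousOn.isOpen_inter_preimage
      (ψ.isOpen_inter_preimage_symm hU) (hJ.isOpen.inter hO)
  have hxW : ψ x ∈ W := by
    rw [hWdef]
    refine ⟨⟨hxt, ?_⟩, ?_⟩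
    · simpa [hxx] using hxU
    · simpa [hxx] using ⟨hxJ, hxO⟩
  have hWsub : ∀ w ∈ W, w ∈ ψ.target ∧ ψ.symm w ∈ U ∧ τ (ψ.symm w) ∈ J ∧ τ (ψ.symm w) ∈ O := by
    intro w hw
    rw [hWdef] at hw
    exact ⟨hw.1.1, hw.1.2, hw.2.1, hw.2.2⟩
  have sτ : ContDiffOn ℝ ∞ (τ ∘ ψ.symm) W :=
    (contDiffOn_comp_symm hψa hτ).mono fun w hw => ⟨(hWsub w hw).1, (hWsub w hw).2.1⟩
  have sC := hssf ψ hψa W (fun w hw => (hWsub w hw).1) (fun w hw => (hWsub w hw).2.1)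
    fun w hw => (hWsub w hw).2.2.1
  have dC := hsf ψ hψa (ψ x) hxt (by rwa [hxx]) (by rwa [hxx])
  rw [hxx] at dC
  have hCX : A₂ (τ x) • fderiv ℝ (f ∘ ψ.symm) (ψ x) X +
      B₂ (τ x) • fderiv ℝ (t ∘ ψ.symm) (ψ x) X ≠ 0 := fun h0 =>
    hX (jx.eq_zero_of_det_ne_zero hD (hker X hτX) h0)
  -- A component of C with nonzero derivative along X will be the coordinate u.
  obtain ⟨i, hi⟩ := Function.ne_iff.1 (smul_ne_zero (hJ.η_ne_zero (τ x)) hCX)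
  have dCi := hasFDerivAt_pi'.1 dC i
  -- The parameter τ is automatically a submersion: otherwise both spheres would be curvature
  -- spheres in the direction Y.
  have hτY : fderiv ℝ (τ ∘ ψ.symm) (ψ x) Y ≠ 0 := by
    intro h0
    have hY0 : Y = 0 := jx.eq_zero_of_det_ne_zero hD (hker Y h0) hY
    exact hXY.ne_zero 1 hY0
  obtain ⟨φ, hφ, hxφ, hφsub, hφW, hφeq⟩ := exists_chart hψa hxψ hW hxW
    ((contDiff_apply ℝ ℝ i).comp_contDiffOn sC) sτ (by
      intro Z hZ1 hZ2
      obtain ⟨r, s, rfl⟩ := exists_eq_of_linearIndependent hXY Z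
      rw [map_add, map_smul, map_smul, hτX, smul_zero, zero_add] at hZ2
      have hs : s = 0 := (smul_eq_zero.1 hZ2).resolve_right hτY
      subst hs
      have hfd : fderiv ℝ ((fun v : R42 => v i) ∘
        secondFamily A₂ B₂ η Γ (f ∘ ψ.symm) (t ∘ ψ.symm) (τ ∘ ψ.symm)) (ψ x) = _ := dCi.fderiv
      rw [zero_smul, add_zero, map_smul, hfd] at hZ1
      have hr : r = 0 := (smul_eq_zero.1 hZ1).resolve_right hi
      rw [hr, zero_smul, zero_smul, add_zero])
  obtain ⟨C, hC⟩ : ∃ C, C = secondFamily A₂ B₂ η Γ (f ∘ φ.symm) (t ∘ φ.symm) (τ ∘ φ.symm) :=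
    ⟨_, rfl⟩
  have hτ1 : ∀ z ∈ φ.source, φ z 1 = τ z := by
    intro z hz
    rw [hφeq z hz, planeMap_one, Function.comp_apply, ψ.left_inv (hφsub hz)]
  have hzJ : ∀ z ∈ φ.source, z ∈ U ∧ τ z ∈ J ∧ τ z ∈ O := by
    intro z hz
    have := (hWsub _ (hφW z hz)).2
    rwa [ψ.left_inv (hφsub hz)] at this
  have hC0 : ∀ z ∈ φ.source, C (φ z) i = φ z 0 := by
    intro z hz
    conv_rhs => rw [hφeq z hz, planeMap_zero]
    simp only [hC, secondFamily, Function.comp_apply, φ.left_inv hz, ψ.left_inv (hφsub hz)]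
  have hw1 : ∀ w ∈ φ.target, τ (φ.symm w) = w 1 := by
    intro w hw
    rw [← hτ1 _ (φ.map_target hw), φ.right_inv hw]
  have hw0 : ∀ w ∈ φ.target, C w i = w 0 := by
    intro w hw
    have := hC0 _ (φ.map_target hw)
    rwa [φ.right_inv hw] at this
  have dCφ : ∀ w ∈ φ.target, HasFDerivAt C (η (w 1) • (A₂ (w 1) • fderiv ℝ (f ∘ φ.symm) w +
      B₂ (w 1) • fderiv ℝ (t ∘ φ.symm) w)) w := by
    intro w hw
    obtain ⟨hzU, hzJ', -⟩ := hzJ _ (φ.map_target hw)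
    have := hsf φ hφ w hw hzU hzJ'
    rwa [hw1 w hw, ← hC] at this
  have hproj : ∀ (j : Fin 2) (w X : Plane), fderiv ℝ (fun v : Plane => v j) w X = X j :=
    fun j w X => by
      rw [← fderiv_coord (Φ := fun v => v) differentiableAt_id X j, fderiv_fun_id]
      rfl
  have hfirst : ∀ w ∈ φ.target, A (w 1) • pd 0 (f ∘ φ.symm) w + B (w 1) • pd 0 (t ∘ φ.symm) w = 0 := by
    intro w hw
    have hk := (hloc φ hφ w hw (hzJ _ (φ.map_target hw)).1).2 (EuclideanSpace.single 0 1)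
    rw [hw1 w hw] at hk
    apply hk
    have : τ ∘ φ.symm =ᶠ[𝓝 w] fun v => v 1 := by
      filter_upwards [φ.open_target.mem_nhds hw] with v hv using hw1 v hv
    rw [this.fderiv_eq, hproj]
    simp
  have hdet : ∀ w ∈ φ.target, A (w 1) * B₂ (w 1) - B (w 1) * A₂ (w 1) ≠ 0 := by
    intro w hw
    have := hJ.det_ne_zero _ (hzJ _ (φ.map_target hw)).2.1
    rwa [hw1 w hw] at this
  have hsecond : ∀ w ∈ φ.target,
      A₂ (w 1) • pd 1 (f ∘ φ.symm) w + B₂ (w 1) • pd 1 (t ∘ φ.symm) w = 0 := by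
    intro w hw
    have jw := h.isLegendreJet humb hLW hφ hw
    have hne' := hne _ (hzJ _ (φ.map_target hw)).1
    rw [hw1 w hw] at hne'
    obtain ⟨-, Z, hZ, hZ'⟩ := jw.exists_second_curvature_direction habc hne'
      (X := EuclideanSpace.single 0 1) (by simp) (hfirst w hw)
    rw [hA₂', hB₂'] at hZ'
    -- The derivative of C along the second curvature direction Z vanishes, and u is a component of
    -- C; hence Z points along the v-axis.
    have hZ0 : Z 0 = 0 := by
      have e1 : (fun v => C v i) =ᶠ[𝓝 w] fun v => v 0 := by
        filter_upwards [φ.open_target.mem_nhds hw] with v hv using hw0 v hv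
      rw [← hproj 0 w Z, ← e1.fderiv_eq, (hasFDerivAt_pi'.1 (dCφ w hw) i).fderiv]
      show (η (w 1) • (A₂ (w 1) • fderiv ℝ (f ∘ φ.symm) w Z +
        B₂ (w 1) • fderiv ℝ (t ∘ φ.symm) w Z)) i = 0
      rw [hZ', smul_zero, Pi.zero_apply]
    have hZ1 : Z = Z 1 • EuclideanSpace.single 1 1 := by
      conv_lhs => rw [plane_eq Z, hZ0, zero_smul, zero_add]
    have hZ1' : Z 1 ≠ 0 := by
      intro h0
      rw [h0, zero_smul] at hZ1
      exact hZ.ne_zero 1 hZ1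
    rw [hZ1, map_smul, map_smul, smul_comm, smul_comm (B₂ (w 1)), ← smul_add] at hZ'
    exact (smul_eq_zero.1 hZ').resolve_left hZ1'
  have horth := fun w hw => (h.isLegendreJet humb hLW hφ hw).ip_eq_zero_of_curvature_directions
    (hdet w hw) (hfirst w hw) (hsecond w hw)
  have hmemJ : ∀ w ∈ φ.target, w 1 ∈ J ∩ O := by
    intro w hw
    rw [← hw1 w hw]
    exact (hzJ _ (φ.map_target hw)).2
  have hpdC : ∀ w ∈ φ.target, pd 1 C w = 0 := by
    intro w hw
    have : pd 1 C w = η (w 1) • (A₂ (w 1) • pd 1 (f ∘ φ.symm) w +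
        B₂ (w 1) • pd 1 (t ∘ φ.symm) w) := by
      rw [pd, (dCφ w hw).fderiv]; rfl
    rw [this, hsecond w hw, smul_zero]
  have hsC : ContDiffOn ℝ ∞ C φ.target := by
    rw [hC]
    exact hssf φ hφ φ.target subset_rfl (fun w hw => (hzJ _ (φ.map_target hw)).1)
      fun w hw => (hzJ _ (φ.map_target hw)).2.1
  have hsplit : ∀ w ∈ φ.target, ∃ k d, k = (η (w 1) * (A (w 1) * B₂ (w 1) - B (w 1) * A₂ (w 1)))⁻¹ ∧
      d = (A (w 1) * B₂ (w 1) - B (w 1) * A₂ (w 1))⁻¹ ∧ η (w 1) * k = d ∧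
      (A (w 1) * B₂ (w 1) - B (w 1) * A₂ (w 1)) * d = 1 ∧
      C w = η (w 1) • (A₂ (w 1) • f (φ.symm w) + B₂ (w 1) • t (φ.symm w)) - Γ (w 1) ∧
      γ (w 1) = A (w 1) • f (φ.symm w) + B (w 1) • t (φ.symm w) := by
    intro w hw
    refine ⟨_, _, rfl, rfl, ?_, mul_inv_cancel₀ (hdet w hw), ?_, ?_⟩
    · rw [mul_inv, mul_inv_cancel_left₀ (hJ.η_ne_zero _)]
    · rw [hC, secondFamily, Function.comp_apply, Function.comp_apply, Function.comp_apply, hw1 w hw]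
    · have := hsec _ (hzJ _ (φ.map_target hw)).1
      rwa [hw1 w hw] at this
  refine ⟨φ, hφ, hxφ, hτ1 x hxφ, ?_, C, ⟨hmemJ, hsC, hpdC, ?_, fun w hw => (horth w hw).1⟩,
    ⟨hmemJ, hsC, hpdC, ?_, fun w hw => (horth w hw).2⟩⟩
  · intro z hz
    have hzt := φ.map_source hz
    have hp := h.isNullPair z
    have hd := hdet _ hzt
    have hli : ∀ r s : ℝ, r • (A (φ z 1) • f z + B (φ z 1) • t z) +
        s • (A₂ (φ z 1) • f z + B₂ (φ z 1) • t z) = 0 → r = 0 ∧ s = 0 := by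
      intro r s hrs
      obtain ⟨e1, e2⟩ := hp.indep (r * A (φ z 1) + s * A₂ (φ z 1)) (r * B (φ z 1) + s * B₂ (φ z 1))
        (by rw [← hrs]; module)
      constructor
      · refine (mul_eq_zero.1 (?_ : _ * r = 0)).resolve_left hd
        linear_combination B₂ (φ z 1) * e1 - A₂ (φ z 1) * e2
      · refine (mul_eq_zero.1 (?_ : _ * s = 0)).resolve_left hd
        linear_combination A (φ z 1) * e2 - B (φ z 1) * e1
    refine ⟨A (φ z 1) • f z + B (φ z 1) • t z, A₂ (φ z 1) • f z + B₂ (φ z 1) • t z,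
      LinearIndependent.pair_iff.2 hli, ⟨fun h0 => ?_, _, _, rfl, ?_⟩, ⟨fun h0 => ?_, _, _, rfl, ?_⟩⟩
    · exact one_ne_zero (hli 1 0 (by rw [h0]; simp)).1
    · rw [coordDeriv, coordDeriv, hfirst _ hzt]; exact zero_mem _
    · exact one_ne_zero (hli 0 1 (by rw [h0]; simp)).2
    · rw [coordDeriv, coordDeriv, hsecond _ hzt]; exact zero_mem _
  · intro w hw
    obtain ⟨k, d, hk, hd, h1, h2, h3, h4⟩ := hsplit w hw
    simp only [← hk, ← hd]
    rw [h3, h4]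
    match_scalars
    · linear_combination -h2 + B (w 1) * A₂ (w 1) * h1
    · linear_combination B (w 1) * B₂ (w 1) * h1
    · ring
  · intro w hw
    obtain ⟨k, d, hk, hd, h1, h2, h3, h4⟩ := hsplit w hw
    simp only [← hk, ← hd]
    rw [h3, h4]
    match_scalars
    · linear_combination -h2 - A (w 1) * B₂ (w 1) * h1
    · linear_combination -A (w 1) * A₂ (w 1) * h1
    · ring

/-! ### Moutard lifts of split charts. -/

section OneVariable

variable {E : Type*} [NormedAddCommGroup E] [NormedSpace ℝ E]

lemma hasFDerivAt_comp_coord {h : ℝ → E} {h' : E} {w : Plane} {j : Fin 2}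
    (hh : HasDerivAt h h' (w j)) :
    HasFDerivAt (fun v : Plane => h (v j))
      ((EuclideanSpace.proj j : Plane →L[ℝ] ℝ).smulRight h') w := by
  have h1 := hh.hasFDerivAt.comp w (EuclideanSpace.proj j : Plane →L[ℝ] ℝ).hasFDerivAt
  refine HasFDerivAt.congr_fderiv h1 ?_
  ext1 X
  simp

lemma fderiv_comp_coord {h : ℝ → E} {w : Plane} {j : Fin 2}
    (hh : DifferentiableAt ℝ h (w j)) (X : Plane) :
    fderiv ℝ (fun v : Plane => h (v j)) w X = X j • deriv h (w j) := by
  rw [(hasFDerivAt_comp_coord hh.hasDerivAt).fderiv]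
  simp

end OneVariable

lemma contDiff_coord (j : Fin 2) : ContDiff ℝ ∞ fun v : Plane => v j :=
  (EuclideanSpace.proj j : Plane →L[ℝ] ℝ).contDiff

/-- Dividing by P leaves the sum C(u) + (E/P)(v), whose mixed derivative is zero; hence μ = 1/P and
ρ = 0. -/
theorem IsSplitChart.hasMoutardLift [IsManifold (𝓡 2) ∞ M] {g : M → R42} {J : Set ℝ} {P : ℝ → ℝ}
    {E : ℝ → R42} {C : Plane → R42} {φ : OpenPartialHomeomorph M Plane}
    (h : IsSplitChart g J P E C φ) (hφ : φ ∈ IsManifold.maximalAtlas (𝓡 2) ∞ M) (hJ : IsOpen J)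
    (hP : ContDiffOn ℝ ∞ P J) (hE : ContDiffOn ℝ ∞ E J) (hP0 : ∀ s ∈ J, P s ≠ 0) :
    HasMoutardLift g φ := by
  have hPi : ContDiffOn ℝ ∞ (fun s => (P s)⁻¹) J := hP.inv hP0
  have hh : ContDiffOn ℝ ∞ (fun s => (P s)⁻¹ • E s) J := hPi.smul hE
  have hh' : ContDiffOn ℝ ∞ (deriv fun s => (P s)⁻¹ • E s) J :=
    ((contDiffOn_infty_iff_deriv_of_isOpen hJ).1 hh).2
  refine ⟨fun z => (P (φ z 1))⁻¹, ?_, fun z hz => inv_ne_zero (hP0 _ (h.mem_J _ (φ.map_source hz))),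
    fun z hz => ⟨0, ?_⟩⟩
  · have h1 : ContMDiffOn (𝓡 2) (𝓡 2) ∞ φ φ.source := contMDiffOn_of_mem_maximalAtlas hφ
    have h2 : ContDiffOn ℝ ∞ (fun w : Plane => (P (w 1))⁻¹) φ.target :=
      hPi.comp (contDiff_coord 1).contDiffOn h.mem_J
    exact h2.contMDiffOn.comp h1 fun y hy => φ.map_source hy
  rw [zero_smul]
  have key : ∀ v ∈ φ.target, pd 1 ((fun w => (P (φ w 1))⁻¹ • g w) ∘ φ.symm) v =
      deriv (fun s => (P s)⁻¹ • E s) (v 1) := by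
    intro v hv
    have e : ((fun w => (P (φ w 1))⁻¹ • g w) ∘ φ.symm) =ᶠ[𝓝 v]
        fun w => C w + (fun s => (P s)⁻¹ • E s) (w 1) := by
      filter_upwards [φ.open_target.mem_nhds hv] with w hw
      simp only [Function.comp_apply, φ.right_inv hw, h.eq_split w hw, smul_add]
      rw [inv_smul_smul₀ (hP0 _ (h.mem_J w hw))]
    have d1 : DifferentiableAt ℝ C v :=
      (h.smooth_C.contDiffAt (φ.open_target.mem_nhds hv)).differentiableAt (by simp)
    have d2 : DifferentiableAt ℝ (fun s => (P s)⁻¹ • E s) (v 1) :=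
      (hh.contDiffAt (hJ.mem_nhds (h.mem_J v hv))).differentiableAt (by simp)
    have hsum := d1.hasFDerivAt.add (hasFDerivAt_comp_coord d2.hasDerivAt)
    have hpd : fderiv ℝ C v (EuclideanSpace.single 1 1) = 0 := h.pd_C v hv
    rw [pd, (hsum.congr_of_eventuallyEq e).fderiv]
    simp [hpd]
  have hzt := φ.map_source hz
  have e : pd 1 ((fun w => (P (φ w 1))⁻¹ • g w) ∘ φ.symm) =ᶠ[𝓝 (φ z)]
      fun v => deriv (fun s => (P s)⁻¹ • E s) (v 1) := by
    filter_upwards [φ.open_target.mem_nhds hzt] with v hv using key v hv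
  rw [coordMixed, pd, e.fderiv_eq, fderiv_comp_coord]
  · simp
  · exact (hh'.contDiffAt (hJ.mem_nhds (h.mem_J _ hzt))).differentiableAt (by simp)

/-! ### Reparametrization of the coordinates -/

/-- Reparametrizing u and v separately only rescales the coordinate directions, which keeps
curvature lines and orthogonality intact. -/
lemma coordDeriv_eq_smul [IsManifold (𝓡 2) ∞ M] {φ φ' : OpenPartialHomeomorph M Plane}
    (hφ' : φ' ∈ IsManifold.maximalAtlas (𝓡 2) ∞ M) {α β : ℝ → ℝ}
    (hsub : φ'.source ⊆ φ.source)
    (heq : ∀ z ∈ φ'.source, φ' z = planeMap (fun w => α (w 0)) (fun w => β (w 1)) (φ z))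
    {g : M → R42} (hg : ContMDiff (𝓡 2) 𝓘(ℝ, R42) ∞ g) {z : M} (hz : z ∈ φ'.source) {α' β' : ℝ}
    (hα : HasDerivAt α α' (φ z 0)) (hβ : HasDerivAt β β' (φ z 1)) :
    coordDeriv φ 0 g z = α' • coordDeriv φ' 0 g z ∧
      coordDeriv φ 1 g z = β' • coordDeriv φ' 1 g z := by
  have hΦ : HasFDerivAt (planeMap (fun w => α (w 0)) (fun w => β (w 1)))
      (((EuclideanSpace.proj 0 : Plane →L[ℝ] ℝ).smulRight (α' • EuclideanSpace.single 0 1)) +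
        ((EuclideanSpace.proj 1 : Plane →L[ℝ] ℝ).smulRight (β' • EuclideanSpace.single 1 1)))
      (φ z) := by
    rw [← hasFDerivWithinAt_univ, hasFDerivWithinAt_euclidean]
    intro i
    fin_cases i
    · refine ((hasFDerivAt_comp_coord hα).congr_fderiv ?_).hasFDerivWithinAt
      ext1 X
      simp
    · refine ((hasFDerivAt_comp_coord hβ).congr_fderiv ?_).hasFDerivWithinAt
      ext1 X
      simp
  have hG' : DifferentiableAt ℝ (g ∘ φ'.symm)
      (planeMap (fun w => α (w 0)) (fun w => β (w 1)) (φ z)) := by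
    rw [← heq z hz]
    exact (contDiffAt_comp_symm hφ' hg (φ'.map_source hz)).differentiableAt (by simp)
  have e : g ∘ φ.symm =ᶠ[𝓝 (φ z)]
      (g ∘ φ'.symm) ∘ planeMap (fun w => α (w 0)) (fun w => β (w 1)) := by
    have hopen := φ.isOpen_inter_preimage_symm φ'.open_source
    have hmem : φ z ∈ φ.target ∩ φ.symm ⁻¹' φ'.source :=
      ⟨φ.map_source (hsub hz), by simpa [φ.left_inv (hsub hz)] using hz⟩
    filter_upwards [hopen.mem_nhds hmem] with v hv
    have h1 := heq _ hv.2
    rw [φ.right_inv hv.1] at h1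
    rw [Function.comp_apply, Function.comp_apply, Function.comp_apply, ← h1, φ'.left_inv hv.2]
  have hd := ((hG'.hasFDerivAt.comp _ hΦ).congr_of_eventuallyEq e).fderiv
  rw [← heq z hz] at hd
  constructor
  · rw [coordDeriv, pd, hd]
    simp [coordDeriv, pd]
  · rw [coordDeriv, pd, hd]
    simp [coordDeriv, pd]

lemma isCurvatureSphereIn_smul {F T FX TX s : R42} {r : ℝ} (hr : r ≠ 0)
    (h : IsCurvatureSphereIn F T (r • FX) (r • TX) s) : IsCurvatureSphereIn F T FX TX s := by
  obtain ⟨hs, A, B, hAB, hmem⟩ := h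
  refine ⟨hs, A, B, hAB, ?_⟩
  rw [smul_comm A, smul_comm B, ← smul_add] at hmem
  exact (Submodule.smul_mem_iff _ hr).1 hmem

/-! ### Coordinate squares and conformal parameters. -/

/-- The point of the plane with coordinates `(u, v)`. -/
def planePoint (u v : ℝ) : Plane := WithLp.toLp 2 ![u, v]

lemma planePoint_eta (w : Plane) : planePoint (w 0) (w 1) = w := by
  ext i
  fin_cases i <;> rfl

lemma planePoint_eq (u v : ℝ) :
    planePoint u v = u • EuclideanSpace.single 0 1 + v • EuclideanSpace.single 1 1 := by
  rw [plane_eq (planePoint u v)]; rfl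

lemma hasDerivAt_planePoint_right (u v : ℝ) :
    HasDerivAt (fun r => planePoint u r) (EuclideanSpace.single 1 1) v := by
  simp only [planePoint_eq]
  simpa using ((hasDerivAt_id v).smul_const (EuclideanSpace.single 1 1 : Plane)).const_add
    (u • EuclideanSpace.single 0 1)

/-- The open square around `w` with side `2 ε`. -/
def square (w : Plane) (ε : ℝ) : Set Plane :=
  {v | v 0 ∈ Set.Ioo (w 0 - ε) (w 0 + ε) ∧ v 1 ∈ Set.Ioo (w 1 - ε) (w 1 + ε)}

lemma isOpen_square (w : Plane) (ε : ℝ) : IsOpen (square w ε) :=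
  (isOpen_Ioo.preimage (contDiff_coord 0).continuous).inter
    (isOpen_Ioo.preimage (contDiff_coord 1).continuous)

lemma self_mem_square (w : Plane) {ε : ℝ} (hε : 0 < ε) : w ∈ square w ε :=
  ⟨⟨by linarith, by linarith⟩, ⟨by linarith, by linarith⟩⟩

lemma square_mono (w : Plane) {ε δ : ℝ} (h : ε ≤ δ) : square w ε ⊆ square w δ :=
  fun _ hv => ⟨⟨by linarith [hv.1.1], by linarith [hv.1.2]⟩,
    ⟨by linarith [hv.2.1], by linarith [hv.2.2]⟩⟩

lemma exists_square_subset {O : Set Plane} (hO : IsOpen O) {w : Plane} (hw : w ∈ O) :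
    ∃ ε > 0, square w ε ⊆ O := by
  obtain ⟨ε, hε, hsub⟩ := Metric.isOpen_iff.1 hO w hw
  refine ⟨ε / 2, by positivity, fun v hv => hsub ?_⟩
  rw [Metric.mem_ball, EuclideanSpace.dist_eq, Real.sqrt_lt' hε, Fin.sum_univ_two,
    Real.dist_eq, Real.dist_eq, sq_abs, sq_abs]
  obtain ⟨⟨h1, h2⟩, ⟨h3, h4⟩⟩ := hv
  have h5 : (v 0 - w 0) ^ 2 < (ε / 2) ^ 2 := sq_lt_sq' (by linarith) (by linarith)
  have h6 : (v 1 - w 1) ^ 2 < (ε / 2) ^ 2 := sq_lt_sq' (by linarith) (by linarith)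
  nlinarith [sq_nonneg ε]

/-- A map on a square with vanishing derivative in the second coordinate depends on the first
coordinate only. -/
lemma eq_of_pd_one_eq_zero {C : Plane → R42} {w : Plane} {ε : ℝ}
    (hC : ∀ v ∈ square w ε, DifferentiableAt ℝ C v) (hpd : ∀ v ∈ square w ε, pd 1 C v = 0)
    {v : Plane} (hv : v ∈ square w ε) : C v = C (planePoint (v 0) (w 1)) := by
  have hd : ∀ r ∈ Set.Ioo (w 1 - ε) (w 1 + ε),
      HasDerivAt (fun r => C (planePoint (v 0) r)) 0 r := by
    intro r hr
    have hmem : planePoint (v 0) r ∈ square w ε := ⟨hv.1, hr⟩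
    have := (hC _ hmem).hasFDerivAt.comp_hasDerivAt r (hasDerivAt_planePoint_right (v 0) r)
    rwa [show fderiv ℝ C (planePoint (v 0) r) (EuclideanSpace.single 1 1) = 0 from hpd _ hmem]
      at this
  have := isOpen_Ioo.is_const_of_deriv_eq_zero isPreconnected_Ioo
    (fun r hr => (hd r hr).differentiableAt.differentiableWithinAt)
    (fun r hr => (hd r hr).deriv) hv.2
    (y := w 1) ⟨by linarith [hv.2.1, hv.2.2], by linarith [hv.2.1, hv.2.2]⟩
  rwa [planePoint_eta] at this

lemma exists_sqrt_antiderivative {n : ℝ → ℝ} {r₁ r₂ : ℝ} (hn : ContDiffOn ℝ ∞ n (Set.Ioo r₁ r₂))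
    (hpos : ∀ s ∈ Set.Ioo r₁ r₂, 0 < n s) :
    ∃ α : ℝ → ℝ, ContDiffOn ℝ ∞ α (Set.Ioo r₁ r₂) ∧
      ∀ s ∈ Set.Ioo r₁ r₂, HasDerivAt α (Real.sqrt (n s)) s :=
  exists_antiderivative (hn.sqrt fun s hs => (hpos s hs).ne')

theorem IsSplitChart.hasConformalCurvatureLineChartAt [IsManifold (𝓡 2) ∞ M] {f t g : M → R42}
    (hf : ContMDiff (𝓡 2) 𝓘(ℝ, R42) ∞ f) (ht : ContMDiff (𝓡 2) 𝓘(ℝ, R42) ∞ t)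
    (hg : ContMDiff (𝓡 2) 𝓘(ℝ, R42) ∞ g) (hnull : ∀ z, ip (g z) (g z) = 0)
    {J : Set ℝ} {P : ℝ → ℝ} {E : ℝ → R42} {C : Plane → R42} {φ : OpenPartialHomeomorph M Plane}
    (h : IsSplitChart g J P E C φ) (hφ : φ ∈ IsManifold.maximalAtlas (𝓡 2) ∞ M) (hJ : IsOpen J)
    (hP : ContDiffOn ℝ ∞ P J) (hE : ContDiffOn ℝ ∞ E J) (hP0 : ∀ s ∈ J, P s ≠ 0)
    (hcurv : IsCurvatureLineChart f t φ) {x : M} (hx : x ∈ φ.source)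
    (hpos : ∀ i, 0 < ip (coordDeriv φ i g x) (coordDeriv φ i g x)) :
    HasConformalCurvatureLineChartAt f t g x := by
  have hh : ContDiffOn ℝ ∞ (fun s => (P s)⁻¹ • E s) J := (hP.inv hP0).smul hE
  obtain ⟨k, hk⟩ : ∃ k : ℝ → R42, k = fun s => (P s)⁻¹ • E s := ⟨_, rfl⟩
  rw [← hk] at hh
  have hk' : ContDiffOn ℝ ∞ (deriv k) J := ((contDiffOn_infty_iff_deriv_of_isOpen hJ).1 hh).2
  have dC : ∀ w ∈ φ.target, DifferentiableAt ℝ C w := fun w hw =>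
    (h.smooth_C.contDiffAt (φ.open_target.mem_nhds hw)).differentiableAt (by simp)
  have hsplit : ∀ w ∈ φ.target, (g ∘ φ.symm) w = P (w 1) • (C w + k (w 1)) := by
    intro w hw
    rw [Function.comp_apply, h.eq_split w hw, smul_add, hk, smul_inv_smul₀ (hP0 _ (h.mem_J w hw))]
  -- the metric in the coordinates `(u, v)`
  have hG : ∀ w ∈ φ.target, ∀ X, fderiv ℝ (g ∘ φ.symm) w X =
      P (w 1) • (fderiv ℝ C w X + X 1 • deriv k (w 1)) +
        (X 1 * deriv P (w 1) * (P (w 1))⁻¹) • (g ∘ φ.symm) w := by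
    intro w hw X
    have hwJ := h.mem_J w hw
    have dP : DifferentiableAt ℝ P (w 1) := (hP.contDiffAt (hJ.mem_nhds hwJ)).differentiableAt (by simp)
    have dk : DifferentiableAt ℝ k (w 1) := (hh.contDiffAt (hJ.mem_nhds hwJ)).differentiableAt (by simp)
    have e : g ∘ φ.symm =ᶠ[𝓝 w] fun v => P (v 1) • (C v + k (v 1)) := by
      filter_upwards [φ.open_target.mem_nhds hw] with v hv using hsplit v hv
    have d := (hasFDerivAt_comp_coord dP.hasDerivAt).smul
      ((dC w hw).hasFDerivAt.add (hasFDerivAt_comp_coord dk.hasDerivAt))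
    rw [(d.congr_of_eventuallyEq e).fderiv, hsplit w hw, smul_smul,
      inv_mul_cancel_right₀ (hP0 _ hwJ)]
    simp
  have hGG : ∀ w ∈ φ.target, ∀ X, ip (fderiv ℝ (g ∘ φ.symm) w X) ((g ∘ φ.symm) w) = 0 := by
    intro w hw X
    have d := (contDiffAt_comp_symm hφ hg hw).differentiableAt (by simp)
    have := ip_fderiv_eq_zero φ.open_target hw d d (fun v _ => hnull (φ.symm v)) X
    rw [ip_comm ((g ∘ φ.symm) w)] at this
    linarith
  have hnorm : ∀ w ∈ φ.target, ∀ X, ip (fderiv ℝ (g ∘ φ.symm) w X) (fderiv ℝ (g ∘ φ.symm) w X) =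
      P (w 1) ^ 2 * ip (fderiv ℝ C w X + X 1 • deriv k (w 1))
        (fderiv ℝ C w X + X 1 • deriv k (w 1)) := by
    intro w hw X
    have e := hGG w hw X
    have hn : ip ((g ∘ φ.symm) w) ((g ∘ φ.symm) w) = 0 := hnull _
    rw [hG w hw X] at e ⊢
    generalize fderiv ℝ C w X + X 1 • deriv k (w 1) = V at *
    simp only [ip_add_left, ip_smul_left, hn, mul_zero, add_zero] at e
    simp only [ip_add_left, ip_add_right, ip_smul_left, ip_smul_right, hn, ip_comm _ V]
    linear_combination 2 * (X 1 * deriv P (w 1) * (P (w 1))⁻¹) * e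
  have hxt := φ.map_source hx
  -- On a square the v-lines are connected, so C reduces there to a curve c(u).
  obtain ⟨ε, hε, hsq⟩ := exists_square_subset φ.open_target hxt
  obtain ⟨c, hc⟩ : ∃ c : ℝ → R42, c = fun u => C (planePoint u (φ x 1)) := ⟨_, rfl⟩
  have hmem : ∀ u ∈ Set.Ioo (φ x 0 - ε) (φ x 0 + ε), planePoint u (φ x 1) ∈ square (φ x) ε :=
    fun u hu => ⟨hu, (self_mem_square (φ x) hε).2⟩
  have sc : ContDiffOn ℝ ∞ c (Set.Ioo (φ x 0 - ε) (φ x 0 + ε)) := by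
    rw [hc]
    refine h.smooth_C.comp (ContDiff.contDiffOn ?_) fun u hu => hsq (hmem u hu)
    simp only [planePoint_eq]
    exact (contDiff_id.smul contDiff_const).add contDiff_const
  have sc' : ContDiffOn ℝ ∞ (deriv c) (Set.Ioo (φ x 0 - ε) (φ x 0 + ε)) :=
    ((contDiffOn_infty_iff_deriv_of_isOpen isOpen_Ioo).1 sc).2
  have hCc : ∀ v ∈ square (φ x) ε, pd 0 C v = deriv c (v 0) := by
    intro v hv
    have e : C =ᶠ[𝓝 v] fun w => c (w 0) := by
      filter_upwards [(isOpen_square _ _).mem_nhds hv] with w hw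
      rw [hc]
      exact eq_of_pd_one_eq_zero (fun w hw => dC w (hsq hw)) (fun w hw => h.pd_C w (hsq hw)) hw
    rw [pd, e.fderiv_eq, fderiv_comp_coord
      ((sc.contDiffAt (isOpen_Ioo.mem_nhds hv.1)).differentiableAt (by simp))]
    simp
  have hm0 : ∀ v ∈ square (φ x) ε, ip (pd 0 (g ∘ φ.symm) v) (pd 0 (g ∘ φ.symm) v) =
      P (v 1) ^ 2 * ip (deriv c (v 0)) (deriv c (v 0)) := by
    intro v hv
    have := hnorm v (hsq hv) (EuclideanSpace.single 0 1)
    rw [show fderiv ℝ C v (EuclideanSpace.single 0 1) = deriv c (v 0) from hCc v hv] at this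
    rw [pd, this]
    simp
  have hm1 : ∀ v ∈ square (φ x) ε, ip (pd 1 (g ∘ φ.symm) v) (pd 1 (g ∘ φ.symm) v) =
      P (v 1) ^ 2 * ip (deriv k (v 1)) (deriv k (v 1)) := by
    intro v hv
    have := hnorm v (hsq hv) (EuclideanSpace.single 1 1)
    rw [show fderiv ℝ C v (EuclideanSpace.single 1 1) = 0 from h.pd_C v (hsq hv)] at this
    rw [pd, this]
    simp
  have hPx : 0 < P (φ x 1) ^ 2 := by
    have := hP0 _ (h.mem_J _ hxt)
    positivity
  have hsx := self_mem_square (φ x) hε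
  have hn0 : 0 < ip (deriv c (φ x 0)) (deriv c (φ x 0)) := by
    have := hpos 0
    rw [coordDeriv, hm0 _ hsx] at this
    exact (pos_iff_pos_of_mul_pos this).1 hPx
  have hn1 : 0 < ip (deriv k (φ x 1)) (deriv k (φ x 1)) := by
    have := hpos 1
    rw [coordDeriv, hm1 _ hsx] at this
    exact (pos_iff_pos_of_mul_pos this).1 hPx
  -- both factors are positive on a smaller square
  have sip : ∀ {l : ℝ → R42} {s : Set ℝ}, ContDiffOn ℝ ∞ l s →
      ContDiffOn ℝ ∞ (fun r => ip (l r) (l r)) s := fun hl =>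
    (ipCLM.contDiff.comp_contDiffOn hl).clm_apply hl
  have s0 := sip sc'
  have s1 := sip hk'
  obtain ⟨δ₀, hδ₀, hsub0⟩ := exists_Ioo_subset
    (s0.continuousOn.isOpen_inter_preimage isOpen_Ioo isOpen_Ioi) ⟨hsx.1, hn0⟩
  obtain ⟨δ₁, hδ₁, hsub1⟩ := exists_Ioo_subset
    (s1.continuousOn.isOpen_inter_preimage hJ isOpen_Ioi) ⟨h.mem_J _ hxt, hn1⟩
  -- The new coordinates are the arc lengths of c and of k = E/P; in them both coordinate vectors
  -- have squared length P².
  obtain ⟨α, sα, hα⟩ := exists_sqrt_antiderivative (s0.mono fun r hr => (hsub0 hr).1)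
    fun r hr => (hsub0 hr).2
  obtain ⟨β, sβ, hβ⟩ := exists_sqrt_antiderivative (s1.mono fun r hr => (hsub1 hr).1)
    fun r hr => (hsub1 hr).2
  obtain ⟨δ, hδ, hδε, hδ0, hδ1⟩ : ∃ δ > 0, δ ≤ ε ∧ δ ≤ δ₀ ∧ δ ≤ δ₁ :=
    ⟨min ε (min δ₀ δ₁), by positivity, min_le_left _ _, (min_le_right _ _).trans (min_le_left _ _),
      (min_le_right _ _).trans (min_le_right _ _)⟩
  have hq0 : ∀ v ∈ square (φ x) δ, v 0 ∈ Set.Ioo (φ x 0 - δ₀) (φ x 0 + δ₀) := fun v hv =>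
    (square_mono _ hδ0 hv).1
  have hq1 : ∀ v ∈ square (φ x) δ, v 1 ∈ Set.Ioo (φ x 1 - δ₁) (φ x 1 + δ₁) := fun v hv =>
    (square_mono _ hδ1 hv).2
  have hr0 : ∀ v ∈ square (φ x) δ, 0 < Real.sqrt (ip (deriv c (v 0)) (deriv c (v 0))) := fun v hv =>
    Real.sqrt_pos.2 (hsub0 (hq0 v hv)).2
  have hr1 : ∀ v ∈ square (φ x) δ, 0 < Real.sqrt (ip (deriv k (v 1)) (deriv k (v 1))) := fun v hv =>
    Real.sqrt_pos.2 (hsub1 (hq1 v hv)).2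
  have hsxδ := self_mem_square (φ x) hδ
  obtain ⟨φ', hφ', hxφ', hsub, hsq', heq⟩ := exists_chart hφ hx (isOpen_square (φ x) δ) hsxδ
    (U := fun w => α (w 0)) (V := fun w => β (w 1))
    (sα.comp (contDiff_coord 0).contDiffOn hq0) (sβ.comp (contDiff_coord 1).contDiffOn hq1) (by
      intro X hX0 hX1
      rw [(hasFDerivAt_comp_coord (hα _ (hq0 _ hsxδ))).fderiv] at hX0
      rw [(hasFDerivAt_comp_coord (hβ _ (hq1 _ hsxδ))).fderiv] at hX1
      have h0 : X 0 * Real.sqrt (ip (deriv c (φ x 0)) (deriv c (φ x 0))) = 0 := hX0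
      have h1 : X 1 * Real.sqrt (ip (deriv k (φ x 1)) (deriv k (φ x 1))) = 0 := hX1
      rw [plane_eq X, (mul_eq_zero.1 h0).resolve_right (hr0 _ hsxδ).ne',
        (mul_eq_zero.1 h1).resolve_right (hr1 _ hsxδ).ne', zero_smul, zero_smul, add_zero])
  have hrep : ∀ l : M → R42, ContMDiff (𝓡 2) 𝓘(ℝ, R42) ∞ l → ∀ z ∈ φ'.source,
      coordDeriv φ 0 l z = Real.sqrt (ip (deriv c (φ z 0)) (deriv c (φ z 0))) • coordDeriv φ' 0 l z ∧
      coordDeriv φ 1 l z = Real.sqrt (ip (deriv k (φ z 1)) (deriv k (φ z 1))) • coordDeriv φ' 1 l z :=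
    fun l hl z hz => coordDeriv_eq_smul hφ' hsub heq hl hz (hα _ (hq0 _ (hsq' z hz)))
      (hβ _ (hq1 _ (hsq' z hz)))
  refine ⟨φ', hφ', hxφ', ?_, ?_⟩
  · intro z hz
    obtain ⟨σ₁, σ₂, hli, h1, h2⟩ := hcurv z (hsub hz)
    rw [(hrep f hf z hz).1, (hrep t ht z hz).1] at h1
    rw [(hrep f hf z hz).2, (hrep t ht z hz).2] at h2
    exact ⟨σ₁, σ₂, hli, isCurvatureSphereIn_smul (hr0 _ (hsq' z hz)).ne' h1,
      isCurvatureSphereIn_smul (hr1 _ (hsq' z hz)).ne' h2⟩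
  · intro z hz
    have hzs := square_mono _ hδε (hsq' z hz)
    have p0 := hr0 _ (hsq' z hz)
    have p1 := hr1 _ (hsq' z hz)
    obtain ⟨e0, e1⟩ := hrep g hg z hz
    have o := h.orthogonal _ (hsq hzs)
    have m0 := hm0 _ hzs
    have m1 := hm1 _ hzs
    rw [show pd 0 (g ∘ φ.symm) (φ z) = _ from e0] at o m0
    rw [show pd 1 (g ∘ φ.symm) (φ z) = _ from e1] at o m1
    have r0 := Real.sq_sqrt (Real.sqrt_pos.1 p0).le
    have r1 := Real.sq_sqrt (Real.sqrt_pos.1 p1).le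
    have hPz : 0 < P (φ z 1) ^ 2 := by
      have := hP0 _ (h.mem_J _ (hsq hzs))
      positivity
    generalize Real.sqrt (ip (deriv c (φ z 0)) (deriv c (φ z 0))) = a at *
    generalize Real.sqrt (ip (deriv k (φ z 1)) (deriv k (φ z 1))) = b at *
    simp only [ip_smul_left, ip_smul_right] at o m0 m1
    have q0 : ip (coordDeriv φ' 0 g z) (coordDeriv φ' 0 g z) = P (φ z 1) ^ 2 := by
      refine mul_left_cancel₀ (pow_pos p0 2).ne' ?_
      linear_combination m0 - P (φ z 1) ^ 2 * r0
    have q1 : ip (coordDeriv φ' 1 g z) (coordDeriv φ' 1 g z) = P (φ z 1) ^ 2 := by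
      refine mul_left_cancel₀ (pow_pos p1 2).ne' ?_
      linear_combination m1 - P (φ z 1) ^ 2 * r1
    refine ⟨?_, q0.trans q1.symm, q0 ▸ hPz⟩
    refine (mul_eq_zero.1 (?_ : (a * b) * _ = 0)).resolve_left (mul_pos p0 p1).ne'
    linear_combination o

/-! ### Split charts at immersed points. -/

lemma coordDeriv_ne_zero [IsManifold (𝓡 2) ∞ M] {φ : OpenPartialHomeomorph M Plane}
    (hφ : φ ∈ IsManifold.maximalAtlas (𝓡 2) ∞ M) {x : M} (hx : x ∈ φ.source) {g : M → R42}
    (hg : ContMDiff (𝓡 2) 𝓘(ℝ, R42) ∞ g) (hinj : Function.Injective (diff g x)) (i : Fin 2) :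
    coordDeriv φ i g x ≠ 0 := by
  obtain ⟨L, hL, hLg⟩ := exists_tangentMap hφ (φ.map_source hx)
  rw [← φ.left_inv hx] at hinj
  rw [coordDeriv, pd, hLg g hg]
  intro h0
  have h1 : diff g (φ.symm (φ x)) 0 = 0 := map_zero (mfderiv (𝓡 2) 𝓘(ℝ, R42) g (φ.symm (φ x)))
  have h2 := hL.1 ((hinj (h0.trans h1.symm)).trans (map_zero L).symm)
  simpa using congrArg (fun v : Plane => v i) h2

/-- At a point where `g` is an immersion the factor of a split chart does not vanish. -/
lemma IsSplitChart.factor_ne_zero [IsManifold (𝓡 2) ∞ M] {g : M → R42} {J : Set ℝ} {P : ℝ → ℝ}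
    {E : ℝ → R42} {C : Plane → R42} {φ : OpenPartialHomeomorph M Plane}
    (h : IsSplitChart g J P E C φ) (hJ : IsOpen J) (hP : ContDiffOn ℝ ∞ P J)
    (hE : ContDiffOn ℝ ∞ E J) {x : M} (hx : x ∈ φ.source) (hne : coordDeriv φ 0 g x ≠ 0) :
    P (φ x 1) ≠ 0 := by
  intro h0
  apply hne
  have hw := φ.map_source hx
  have hwJ := hJ.mem_nhds (h.mem_J _ hw)
  have dP : DifferentiableAt ℝ P (φ x 1) := (hP.contDiffAt hwJ).differentiableAt (by simp)
  have dE : DifferentiableAt ℝ E (φ x 1) := (hE.contDiffAt hwJ).differentiableAt (by simp)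
  have dC : DifferentiableAt ℝ C (φ x) :=
    (h.smooth_C.contDiffAt (φ.open_target.mem_nhds hw)).differentiableAt (by simp)
  have e : g ∘ φ.symm =ᶠ[𝓝 (φ x)] fun v => P (v 1) • C v + E (v 1) := by
    filter_upwards [φ.open_target.mem_nhds hw] with v hv using h.eq_split v hv
  have d := ((hasFDerivAt_comp_coord dP.hasDerivAt).smul dC.hasFDerivAt).add
    (hasFDerivAt_comp_coord dE.hasDerivAt)
  rw [coordDeriv, pd, (d.congr_of_eventuallyEq e).fderiv]
  simp [h0]

end LieSphere

end

/-! ### The main theorem. -/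

theorem mainTheorem3 {M : Type*} [TopologicalSpace M] [ChartedSpace LieSphere.Plane M]
    [IsManifold (𝓡 2) ∞ M] (p q : LieSphere.R42) (hpq : LieSphere.IsSpaceForm p q)
    (f t : M → LieSphere.R42) (hsurf : LieSphere.IsSurface p q f t)
    (humb : LieSphere.IsUmbilicFree f t)
    (hLW : LieSphere.IsNonTubularLinearWeingarten p q f t)
    (hch : LieSphere.IsChannel f t) :
    -- conformal curvature line parameters, for the surface and for its tangent plane congruence
    (∀ x, Function.Injective (LieSphere.diff f x) →
      LieSphere.HasConformalCurvatureLineChartAt f t f x) ∧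
    (∀ x, Function.Injective (LieSphere.diff t x) →
      LieSphere.HasConformalCurvatureLineChartAt f t t x) ∧
    -- Moutard lifts, also across other singularities of the two congruences
    (∀ x γ τ, LieSphere.EnvelopsNear f t x γ τ →
      (LieSphere.ip (γ (τ x)) p ≠ 0 → LieSphere.IsIsothermicAt f t f x) ∧
      (LieSphere.ip (γ (τ x)) q ≠ 0 → LieSphere.IsIsothermicAt f t t x)) := by
  obtain ⟨a, b, c, habc, hw⟩ := hLW
  -- positivity of the induced metrics where they are immersed
  have pos_f : ∀ x, ∀ φ ∈ IsManifold.maximalAtlas (𝓡 2) ∞ M, x ∈ φ.source →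
      Function.Injective (LieSphere.diff f x) → ∀ i,
      0 < LieSphere.ip (LieSphere.coordDeriv φ i f x) (LieSphere.coordDeriv φ i f x) := by
    intro x φ hφ hx hinj i
    have j := hsurf.isLegendreJet humb hw hφ (φ.map_source hx)
    have hne := LieSphere.coordDeriv_ne_zero hφ hx hsurf.smooth_f hinj i
    have h1 := j.ip_self_nonneg 1 0 (EuclideanSpace.single i 1)
    have h2 := j.eq_zero_of_ip_self (A := 1) (B := 0) (X := EuclideanSpace.single i 1)
    simp only [one_smul, zero_smul, add_zero] at h1 h2
    exact lt_of_le_of_ne h1 fun h0 => hne (h2 h0.symm)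
  have pos_t : ∀ x, ∀ φ ∈ IsManifold.maximalAtlas (𝓡 2) ∞ M, x ∈ φ.source →
      Function.Injective (LieSphere.diff t x) → ∀ i,
      0 < LieSphere.ip (LieSphere.coordDeriv φ i t x) (LieSphere.coordDeriv φ i t x) := by
    intro x φ hφ hx hinj i
    have j := hsurf.isLegendreJet humb hw hφ (φ.map_source hx)
    have hne := LieSphere.coordDeriv_ne_zero hφ hx hsurf.smooth_t hinj i
    have h1 := j.ip_self_nonneg 0 1 (EuclideanSpace.single i 1)
    have h2 := j.eq_zero_of_ip_self (A := 0) (B := 1) (X := EuclideanSpace.single i 1)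
    simp only [one_smul, zero_smul, zero_add] at h1 h2
    exact lt_of_le_of_ne h1 fun h0 => hne (h2 h0.symm)
  refine ⟨fun x hinj => ?_, fun x hinj => ?_, fun x γ τ henv => ⟨fun hγp => ?_, fun hγq => ?_⟩⟩
  · obtain ⟨γ, τ, henv⟩ := hch x
    obtain ⟨J, P, P', E, E', hJ, hxJ, hP, hE, hP', hE', hPz, hPz', hchart⟩ :=
      LieSphere.exists_split_chart hsurf humb habc hw henv
    -- An unrestricted chart serves only to show that P does not vanish at τ x; a second chart is
    -- then taken inside the set where P ≠ 0.
    have hPx : P (τ x) ≠ 0 := by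
      obtain ⟨φ, hφ, hx, hφx, -, C, hC, -⟩ := hchart Set.univ isOpen_univ trivial
      rw [Set.inter_univ] at hC
      rw [← hφx]
      exact hC.factor_ne_zero hJ hP hE hx
        (LieSphere.coordDeriv_ne_zero hφ hx hsurf.smooth_f hinj 0)
    have hO := hP.continuousOn.isOpen_inter_preimage hJ isOpen_ne (t := {y | y ≠ 0})
    obtain ⟨φ, hφ, hx, hφx, hcurv, C, hC, -⟩ := hchart _ hO ⟨hxJ, hPx⟩
    exact hC.hasConformalCurvatureLineChartAt hsurf.smooth_f hsurf.smooth_t hsurf.smooth_f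
      (fun z => (hsurf.mem_f z).1) hφ (hJ.inter hO) (hP.mono Set.inter_subset_left)
      (hE.mono Set.inter_subset_left) (fun s hs => hs.2.2) hcurv hx (pos_f x φ hφ hx hinj)
  · obtain ⟨γ, τ, henv⟩ := hch x
    obtain ⟨J, P, P', E, E', hJ, hxJ, hP, hE, hP', hE', hPz, hPz', hchart⟩ :=
      LieSphere.exists_split_chart hsurf humb habc hw henv
    have hPx : P' (τ x) ≠ 0 := by
      obtain ⟨φ, hφ, hx, hφx, -, C, -, hC⟩ := hchart Set.univ isOpen_univ trivial
      rw [Set.inter_univ] at hC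
      rw [← hφx]
      exact hC.factor_ne_zero hJ hP' hE' hx
        (LieSphere.coordDeriv_ne_zero hφ hx hsurf.smooth_t hinj 0)
    have hO := hP'.continuousOn.isOpen_inter_preimage hJ isOpen_ne (t := {y | y ≠ 0})
    obtain ⟨φ, hφ, hx, hφx, hcurv, C, -, hC⟩ := hchart _ hO ⟨hxJ, hPx⟩
    exact hC.hasConformalCurvatureLineChartAt hsurf.smooth_f hsurf.smooth_t hsurf.smooth_t
      (fun z => (hsurf.mem_t z).1) hφ (hJ.inter hO) (hP'.mono Set.inter_subset_left)
      (hE'.mono Set.inter_subset_left) (fun s hs => hs.2.2) hcurv hx (pos_t x φ hφ hx hinj)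
  · obtain ⟨J, P, P', E, E', hJ, hxJ, hP, hE, hP', hE', hPz, hPz', hchart⟩ :=
      LieSphere.exists_split_chart hsurf humb habc hw henv
    have hO := hP.continuousOn.isOpen_inter_preimage hJ isOpen_ne (t := {y | y ≠ 0})
    obtain ⟨φ, hφ, hx, hφx, hcurv, C, hC, -⟩ :=
      hchart _ hO ⟨hxJ, fun h0 => hγp ((hPz _ hxJ).1 h0)⟩
    exact ⟨φ, hφ, hx, hcurv, hC.hasMoutardLift hφ (hJ.inter hO) (hP.mono Set.inter_subset_left)
      (hE.mono Set.inter_subset_left) fun s hs => hs.2.2⟩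
  · obtain ⟨J, P, P', E, E', hJ, hxJ, hP, hE, hP', hE', hPz, hPz', hchart⟩ :=
      LieSphere.exists_split_chart hsurf humb habc hw henv
    have hO := hP'.continuousOn.isOpen_inter_preimage hJ isOpen_ne (t := {y | y ≠ 0})
    obtain ⟨φ, hφ, hx, hφx, hcurv, C, -, hC⟩ :=
      hchart _ hO ⟨hxJ, fun h0 => hγq ((hPz' _ hxJ).1 h0)⟩
    exact ⟨φ, hφ, hx, hcurv, hC.hasMoutardLift hφ (hJ.inter hO) (hP'.mono Set.inter_subset_left)
      (hE'.mono Set.inter_subset_left) fun s hs => hs.2.2⟩
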